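/- **Game.** There are $N$ agents; agent $i$ chooses $x_i\in\mathbb R^{m_i}$ (unconstrained), $m=\sum_i m_i$, and minimizes $J_i(x_i,\boldsymbol x_{-i})$. Each $J_i:\mathbb R^m\to\mathbb R$ is continuously differentiable and strictly convex in $x_i$ for every fixed $\boldsymbol x_{-i}$. The pseudogradient $F(\boldsymbol x)=\operatorname{col}(\nabla_{x_i}J_i(\boldsymbol x))_{i}$ is $\mu_{\rm f}$-strongly monotone, $\langle \boldsymbol x-\boldsymbol y,F(\boldsymbol x)-F(\boldsymbol y)\rangle\ge\mu_{\rm f}\|\boldsymbol x-\boldsymbol y\|^2$ with $\mu_{\rm f}>0$, and $L$-Lipschitz on $\mathbb R^m$. **Sampling.** Agent $i$ has sampling period $T_i>0$, and $T_1:\dots:T_N=p_1:\dots:p_N$ for some positive integers $p_i$; let $p=\operatorname{lcm}(p_1,\dots,p_N)$ and $r_i=p/p_i$. The timers $\boldsymbol\tau$ evolve in a closed set $\mathcal T\subset[0,1]^N$ that is forward invariant under the timer dynamics below and contains no point with two timers equal to $1$ (no concurrent sampling). $\mathcal T_{\rm R}$ is the set of $\boldsymbol\tau\in\mathcal T$ with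 some $\tau_i=1$. **Frequencies.** $\omega_i^j>0$ for $j\le m_i$; $\omega_i^j\notin\pi\mathbb Z$ for all $(i,j)$; and $r_i\omega_i^j\pm r_u\omega_u^v\notin2\pi\mathbb Z$ whenever $(i,j)\ne(u,v)$. **Algorithm.** For $\alpha,\beta>0$ and amplitudes $a_c>0$, one for each of the $m$ scalar coordinates, put $A=\operatorname{diag}(a_c)$ and $\bar a=\max_c a_c$. The state is $(\boldsymbol x,\boldsymbol\xi,\boldsymbol\mu,\boldsymbol\tau,\boldsymbol\kappa,k,t)\in\mathbb R^m\times\mathbb R^m\times\mathbb S^m\times\mathcal T\times\mathbb N^{N+1}\times\mathbb R$, where $\mathbb S^m\subset\mathbb R^{2m}$ is the product of $m$ unit circles. The state flows by $\dot\tau_i=1/T_i$, $\dot t=1$, all other components constant, while $\boldsymbol\tau\in\mathcal T$. It jumps when $\boldsymbol\tau\in\mathcal T_{\rm R}$. At a jump every agent $i$ with $\tau_i=1$ sets $$x_i^+=x_i-\alpha\beta\xi_i,\quad \xi_i^+=\xi_i+\alpha\bigl(2A_i^{-1}J_i(\boldsymbol x+A\mathbb D\boldsymbol\mu)\,\mathbb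 D_i\mu_i-\xi_i\bigr),\quad \mu_i^+=\mathcal R_i\mu_i,\quad \tau_i^+=0,\quad \kappa_i^+=\kappa_i+1,$$ the other agents' components are unchanged, $k^+=k+1$ and $t^+=t$. Here $\mathbb D$ (with blocks $\mathbb D_i$) selects the first component of each of the $m$ oscillators, $A_i$ is the block of $A$ of agent $i$, and $\mathcal R_i$ rotates its $j$-th oscillator by the angle $\omega_i^j$. **Claim.** The game has exactly one Nash equilibrium $\boldsymbol x^*$, and the set $\mathcal A=\{\boldsymbol x^*\}\times\mathbb R^m\times\mathbb S^m\times\mathcal T\times\mathbb N^{N+1}\times\mathbb R$ is semi-globally practically asymptotically stable (SGPAS) as $(\alpha,\bar a,\beta)\to0$, in the following sense. There is a function $b$ of class $\mathcal{KL}$ such that for all $\delta>\nu>0$ and $\rho\ge1$ there is $\beta^*>0$ such that for every $\beta\in(0,\beta^*)$ there is $a^*>0$ such that for all amplitudes $a$ with all $a_c\in(0,a^*)$ and all ratios $a_c/a_d\le\rho$ there is $\alpha^*>0$ such that for every $\alpha\in(0,\alpha^*)$ every solution $z$ of the hybrid system with $|z(0,0)|_{\mathcal A}\le\delta$ and $\|\boldsymbol\xi(0,0)\|\le\delta$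 satisfies $$|z(t,j)|_{\mathcal A}\le b\bigl(|z(0,0)|_{\mathcal A},\,\alpha\beta(t+j)\bigr)+\nu\qquad\text{for all }(t,j)\in\operatorname{dom}z,$$ where $|\cdot|_{\mathcal A}$ is the distance to $\mathcal A$. -/

import Mathlib

open MeasureTheory Set Filter Topology

noncomputable section

/-! Hybrid dynamical systems and their solutions -/

/-- A hybrid dynamical system with single-valued flow and jump maps:
`ż = flowMap z` on `flowSet`, `z⁺ = jumpMap z` on `jumpSet`. -/
structure HybridSystem (E : Type*) where
  flowSet : Set E
  flowMap : E → E
  jumpSet : Set E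
  jumpMap : E → E

/-- A compact hybrid time domain: `⋃_{j ≤ J} [t_j, t_{j+1}] × {j}` for some
`0 = t_0 ≤ t_1 ≤ ⋯ ≤ t_{J+1}`. -/
def IsCompactHybridTimeDomain (S : Set (ℝ × ℕ)) : Prop :=
  ∃ (J : ℕ) (t : ℕ → ℝ), t 0 = 0 ∧ Monotone t ∧
    S = {q | q.2 ≤ J ∧ t q.2 ≤ q.1 ∧ q.1 ≤ t (q.2 + 1)}

/-- A hybrid time domain: all its truncations are compact hybrid time domains. -/
def IsHybridTimeDomain (S : Set (ℝ × ℕ)) : Prop :=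
  ∀ p ∈ S, IsCompactHybridTimeDomain {q ∈ S | 0 ≤ q.1 ∧ q.1 ≤ p.1 ∧ q.2 ≤ p.2}

/-- `φ` (a hybrid arc with hybrid time domain `dom`) is a solution of the hybrid system `H`. -/
structure HybridSystem.IsSolution {E : Type*} [NormedAddCommGroup E] [NormedSpace ℝ E]
    (H : HybridSystem E) (dom : Set (ℝ × ℕ)) (φ : ℝ → ℕ → E) : Prop where
  domain : IsHybridTimeDomain dom
  zero_mem : ((0 : ℝ), 0) ∈ dom
  init : φ 0 0 ∈ closure H.flowSet ∪ H.jumpSet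
  absCont : ∀ j a b, (a, j) ∈ dom → (b, j) ∈ dom →
    AbsolutelyContinuousOnInterval (fun t => φ t j) a b
  flow_mem : ∀ j, ∀ t ∈ interior {t | (t, j) ∈ dom}, φ t j ∈ H.flowSet
  flow : ∀ j, ∀ᵐ t : ℝ, t ∈ interior {t | (t, j) ∈ dom} →
    HasDerivAt (fun s => φ s j) (H.flowMap (φ t j)) t
  jump : ∀ j t, (t, j) ∈ dom → (t, j + 1) ∈ dom →
    φ t j ∈ H.jumpSet ∧ φ t (j + 1) = H.jumpMap (φ t j)

/-- Class `𝒦ℒ` functions on `ℝ₊ × ℝ₊` (values outside are irrelevant). -/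
structure IsClassKL (b : ℝ → ℝ → ℝ) : Prop where
  cont : ContinuousOn (fun q : ℝ × ℝ => b q.1 q.2) (Ici 0 ×ˢ Ici 0)
  zero : ∀ s, 0 ≤ s → b 0 s = 0
  strictMono : ∀ s, 0 ≤ s → StrictMonoOn (fun r => b r s) (Ici 0)
  anti : ∀ r, 0 ≤ r → AntitoneOn (fun s => b r s) (Ici 0)
  tendsto : ∀ r, 0 ≤ r → Tendsto (fun s => b r s) atTop (𝓝 0)

/-- Semi-global practical asymptotic stability of a set `A`, as `(α, ā, β) → 0`, for a family
`H α a β` of hybrid systems with step parameters `α, β > 0` and a vector `a` of amplitudes, where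
`ā = max a`.  The parameters are tuned in the order `β`, then `a`, then `α`.
* The decay is measured in the slow time `α β (t + j)`, with one `𝒦ℒ` function for all parameters.
* `aux` is a component of the state along which `A` may be unbounded; its initial
  values range over an arbitrary ball that is fixed before the parameters are tuned.
* The amplitudes tend to zero at comparable rates: their mutual ratios are at most `ρ`,
  where `ρ` is arbitrary but fixed before the parameters are tuned. -/
def IsSGPAS {E W ι : Type*} [NormedAddCommGroup E] [NormedSpace ℝ E] [NormedAddCommGroup W]
    (H : ℝ → (ι → ℝ) → ℝ → HybridSystem E) (A : Set E) (aux : E → W) : Prop :=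
  ∃ b : ℝ → ℝ → ℝ, IsClassKL b ∧
    ∀ δ ν ρ : ℝ, 0 < ν → ν < δ → 1 ≤ ρ →
      ∃ βs > 0, ∀ β ∈ Ioo 0 βs,
        ∃ as > 0, ∀ a : ι → ℝ, (∀ c, a c ∈ Ioo 0 as) → (∀ c d, a c ≤ ρ * a d) →
          ∃ αs > 0, ∀ α ∈ Ioo 0 αs,
            ∀ (dom : Set (ℝ × ℕ)) (φ : ℝ → ℕ → E), (H α a β).IsSolution dom φ →
              Metric.infDist (φ 0 0) A ≤ δ → ‖aux (φ 0 0)‖ ≤ δ →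
                ∀ t j, (t, j) ∈ dom →
                  Metric.infDist (φ t j) A
                    ≤ b (Metric.infDist (φ 0 0) A) (α * β * (t + j)) + ν

/-! Nash equilibrium problems with `N` agents, agent `i` having a decision in `ℝ^(m i)` -/

/-- The scalar coordinates of the collective decision vector: pairs (agent, index). -/
abbrev Coord {N : ℕ} (m : Fin N → ℕ) : Type := (i : Fin N) × Fin (m i)

/-- Collective decision vectors, `ℝ^m` with `m = ∑ i, m i`. -/
abbrev Decision {N : ℕ} (m : Fin N → ℕ) : Type := EuclideanSpace ℝ (Coord m)

/-- The decision vectors that agree with `x` in the decisions of all agents other than `i`. -/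
def agentSlice {N : ℕ} {m : Fin N → ℕ} (i : Fin N) (x : Decision m) : Set (Decision m) :=
  {y | ∀ c : Coord m, c.1 ≠ i → y c = x c}

/-- `x` is a Nash equilibrium of the unconstrained game with costs `J`. -/
def IsNash {N : ℕ} {m : Fin N → ℕ} (J : Fin N → Decision m → ℝ) (x : Decision m) : Prop :=
  ∀ i, ∀ y ∈ agentSlice i x, J i x ≤ J i y

/-- The pseudogradient: its coordinates belonging to agent `i` are the partial derivatives of
`J i` with respect to the coordinates of agent `i`. -/
def pseudogradient {N : ℕ} {m : Fin N → ℕ} (J : Fin N → Decision m → ℝ) (x : Decision m) :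
    Decision m :=
  WithLp.toLp 2 fun c => fderiv ℝ (J c.1) x (EuclideanSpace.single c 1)

/-! Timers -/

/-- Timer vectors. -/
abbrev Timers (N : ℕ) : Type := EuclideanSpace ℝ (Fin N)

/-- The timer reset: the timers that have reached `1` are set to `0`. -/
def resetTimers {N : ℕ} (τ : Timers N) : Timers N :=
  WithLp.toLp 2 fun i => if τ i = 1 then 0 else τ i

/-- `𝒯` is an admissible set of timer values for the sampling periods `T`: a closed subset of
`[0,1]^N` without concurrent sampling, invariant under the timer dynamics. -/
structure IsTimerSet {N : ℕ} (T : Fin N → ℝ) (𝒯 : Set (Timers N)) : Prop where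
  closed : IsClosed 𝒯
  mem_Icc : ∀ τ ∈ 𝒯, ∀ i, τ i ∈ Icc (0 : ℝ) 1
  no_concurrent : ∀ τ ∈ 𝒯, ∀ i j, τ i = 1 → τ j = 1 → i = j
  flow_inv : ∀ τ ∈ 𝒯, ∀ s : ℝ, 0 ≤ s → (∀ i, τ i + s / T i ≤ 1) →
    WithLp.toLp 2 (fun i => τ i + s / T i) ∈ 𝒯
  jump_inv : ∀ τ ∈ 𝒯, (∃ i, τ i = 1) → resetTimers τ ∈ 𝒯

/-- `r i = p / p i`, where `p` is the least common multiple of all the `p i`. -/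
def scaledRate {N : ℕ} (p : Fin N → ℕ) (i : Fin N) : ℕ := Finset.univ.lcm p / p i

/-! The zeroth-order asynchronous pseudogradient algorithm -/

/-- Oscillator states: a vector of `ℝ²` for each coordinate of the decision vector. -/
abbrev Oscillators {N : ℕ} (m : Fin N → ℕ) : Type := EuclideanSpace ℝ (Coord m × Fin 2)

/-- The product of unit circles, one for each coordinate of the decision vector. -/
def circles {N : ℕ} (m : Fin N → ℕ) : Set (Oscillators m) :=
  {μ | ∀ c, μ (c, 0) ^ 2 + μ (c, 1) ^ 2 = 1}

/-- Rotation of the oscillator of each coordinate `c` by the angle `ω c`. -/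
def rotate {N : ℕ} {m : Fin N → ℕ} (ω : Coord m → ℝ) (μ : Oscillators m) : Oscillators m :=
  WithLp.toLp 2 fun q =>
    if q.2 = 0 then Real.cos (ω q.1) * μ (q.1, 0) - Real.sin (ω q.1) * μ (q.1, 1)
    else Real.sin (ω q.1) * μ (q.1, 0) + Real.cos (ω q.1) * μ (q.1, 1)

/-- The perturbed decision vector `x + A 𝔻 μ`, with `A = diag(a)` and `𝔻` selecting the first
component of every oscillator. -/
def dithered {N : ℕ} {m : Fin N → ℕ} (a : Coord m → ℝ) (x : Decision m) (μ : Oscillators m) :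
    Decision m :=
  WithLp.toLp 2 fun c => x c + a c * μ (c, 0)

/-- The zeroth-order estimate `2 A⁻¹ J(x + A 𝔻 μ) 𝔻 μ` of the pseudogradient. -/
def gradEstimate {N : ℕ} {m : Fin N → ℕ} (J : Fin N → Decision m → ℝ) (a : Coord m → ℝ)
    (x : Decision m) (μ : Oscillators m) : Decision m :=
  WithLp.toLp 2 fun c => 2 / a c * J c.1 (dithered a x μ) * μ (c, 0)

/-- The state space, with states `(x, ξ, μ, τ, κ, k, t)`: decisions, filters, oscillators, timers,
private event counters, global event counter, global time. -/
abbrev AlgState {N : ℕ} (m : Fin N → ℕ) : Type :=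
  Decision m × Decision m × Oscillators m × Timers N × EuclideanSpace ℝ (Fin N) × ℝ × ℝ

/-- The states with `x ∈ X`, `ξ ∈ ℝ^m`, `μ ∈ 𝕊^m`, `τ ∈ 𝒮`, `(κ, k) ∈ ℕ^(N+1)`, `t ∈ ℝ`. -/
def stateSet {N : ℕ} {m : Fin N → ℕ} (X : Set (Decision m)) (𝒮 : Set (Timers N)) :
    Set (AlgState m) :=
  {z | match z with
    | (x, _, μ, τ, κ, k, _) => x ∈ X ∧ μ ∈ circles m ∧ τ ∈ 𝒮 ∧
        (∀ i, ∃ n : ℕ, κ i = n) ∧ (∃ n : ℕ, k = n)}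

/-- The filter component of a state. -/
def filterState {N : ℕ} {m : Fin N → ℕ} (z : AlgState m) : Decision m := z.2.1

/-- The flow map: timer `i` grows at the rate `1 / T i`, the global time at rate `1`. -/
def algFlow {N : ℕ} {m : Fin N → ℕ} (T : Fin N → ℝ) (_z : AlgState m) : AlgState m :=
  (0, 0, 0, WithLp.toLp 2 (fun i => 1 / T i), 0, 0, 1)

/-- The jump map: the agents whose timers equal `1` update their decisions, filters and oscillators,
reset their timers and increase their counters; the states of the other agents do not change. -/
def algJump {N : ℕ} {m : Fin N → ℕ} (J : Fin N → Decision m → ℝ) (ω : Coord m → ℝ)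
    (α : ℝ) (a : Coord m → ℝ) (β : ℝ) : AlgState m → AlgState m
  | (x, ξ, μ, τ, κ, k, t) =>
    (WithLp.toLp 2 fun c => if τ c.1 = 1 then x c - α * β * ξ c else x c,
     WithLp.toLp 2 fun c =>
      if τ c.1 = 1 then ξ c + α * (gradEstimate J a x μ c - ξ c) else ξ c,
     WithLp.toLp 2 fun q => if τ q.1.1 = 1 then rotate ω μ q else μ q,
     resetTimers τ,
     WithLp.toLp 2 fun i => if τ i = 1 then κ i + 1 else κ i,
     k + 1,
     t)

/-- The zeroth-order asynchronous pseudogradient algorithm as a hybrid system. -/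
def zerothOrderAlgorithm {N : ℕ} {m : Fin N → ℕ} (J : Fin N → Decision m → ℝ) (ω : Coord m → ℝ)
    (T : Fin N → ℝ) (𝒯 : Set (Timers N)) (α : ℝ) (a : Coord m → ℝ) (β : ℝ) :
    HybridSystem (AlgState m) where
  flowSet := stateSet univ 𝒯
  flowMap := algFlow T
  jumpSet := stateSet univ {τ ∈ 𝒯 | ∃ i, τ i = 1}
  jumpMap := algJump J ω α a β

end

noncomputable section

/-! Nash equilibria and zeros of the pseudogradient -/

/-! The argument is discrete averaging followed by a Lyapunov estimate for the averaged
two-time-scale dynamics. Convexity in the own variable makes Nash equilibria the zeros of the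
pseudogradient F; strong monotonicity and Lipschitz continuity give exactly one zero.

Decisions, filters and oscillators change only at jumps, and every jump belongs to a single agent. A
solution therefore reduces to a sequence of sampling events (`exists_eventRun`), and hybrid time is
comparable to the number of events.

Averaging rests on two facts about event sequences. Timers stay in [0,1], so each agent acts with an
asymptotic frequency up to a bounded error. Since the periods are commensurable, the order of the
agents repeats after R = ∑ r i events, over which the phase of coordinate c advances by r ω.
Non-resonance then makes window sums of single dither signals and of products of two different ones
bounded, while squares have mean one half (`exists_window_bound`). A first-order Taylor expansion of
the costs turns this into a statement on the gradient estimate: its window sum is frequency times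
partial derivative times window length, up to a small multiple of the length and a constant that
depends on the amplitudes. With blocks of l events, l large enough to dominate that constant and α
small enough that the state hardly moves within a block, every block is a perturbed Euler step, of
size h = α l, of x' = -β Q ξ, ξ' = Q (F x - ξ), where Q is the diagonal matrix of event frequencies
(`exists_block_averaging`).

For small β the filter is fast and tracks F x. The function |Q^(-1/2)(x - x*)| + (4β/q₀) |ξ - F x|,
with q₀ the least frequency, contracts at every block up to the perturbation (`lyapunov_step`);
iteration gives an exponential bound (`exists_run_bound`).

The order of the parameters is forced by the constants. A small β makes the weight of the initial
filter error small, so this error is absorbed in ν and does not enter the 𝒦ℒ function. Then β fixes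
the ball on which averaging must hold, the amplitudes are chosen for the Taylor remainder, and α is
chosen after the block length. -/

theorem eq_sum_single {ι : Type*} [Fintype ι] [DecidableEq ι] (v : EuclideanSpace ℝ ι) :
    v = ∑ c, v c • EuclideanSpace.single c (1 : ℝ) := by
  ext d
  simp [Finset.sum_apply, Pi.single_apply]

theorem fderiv_apply_eq_sum {N : ℕ} {m : Fin N → ℕ} (f : Decision m → ℝ) (x v : Decision m) :
    fderiv ℝ f x v = ∑ c, v c * fderiv ℝ f x (EuclideanSpace.single c 1) := by
  conv_lhs => rw [eq_sum_single v]
  simp [map_sum]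

theorem IsNash.pseudogradient_eq_zero {N : ℕ} {m : Fin N → ℕ} {J : Fin N → Decision m → ℝ}
    (hJ : ∀ i, ContDiff ℝ 1 (J i)) {x : Decision m} (hx : IsNash J x) :
    pseudogradient J x = 0 := by
  ext c
  set e : Decision m := EuclideanSpace.single c 1
  have hd : HasDerivAt (fun t : ℝ => J c.1 (x + t • e)) (fderiv ℝ (J c.1) x e) 0 := by
    have h1 : HasFDerivAt (J c.1) (fderiv ℝ (J c.1) x) (x + (0 : ℝ) • e) := by
      simpa using ((hJ c.1).differentiable (by simp) x).hasFDerivAt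
    have h2 : HasDerivAt (fun t : ℝ => x + t • e) e 0 := by
      simpa using ((hasDerivAt_id (0 : ℝ)).smul_const e).const_add x
    exact h1.comp_hasDerivAt (0 : ℝ) h2
  have hmin : IsLocalMin (fun t : ℝ => J c.1 (x + t • e)) 0 := by
    refine Filter.Eventually.of_forall fun t => ?_
    simp only [zero_smul, add_zero]
    refine hx c.1 _ fun d hd => ?_
    have : d ≠ c := fun h => hd (by rw [h])
    simp [e, this]
  simpa [pseudogradient] using hmin.hasDerivAt_eq_zero hd

/-- Moving from x to y changes only the coordinates of agent i, on which the derivative of `J i`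
vanishes. A convex function on a line with zero derivative at 0 has its minimum there. -/
theorem isNash_of_pseudogradient_eq_zero {N : ℕ} {m : Fin N → ℕ} {J : Fin N → Decision m → ℝ}
    (hJ : ∀ i, ContDiff ℝ 1 (J i)) (hconv : ∀ i x, ConvexOn ℝ (agentSlice i x) (J i))
    {x : Decision m} (hx : pseudogradient J x = 0) : IsNash J x := by
  intro i y hy
  set v : Decision m := y - x
  have hdv : fderiv ℝ (J i) x v = 0 := by
    rw [fderiv_apply_eq_sum]
    refine Finset.sum_eq_zero fun c _ => ?_
    by_cases hc : c.1 = i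
    · have := congrArg (fun w : Decision m => w c) hx
      simp only [pseudogradient] at this
      rw [hc] at this
      simp at this
      simp [this]
    · simp [v, hy c hc]
  have hd : HasDerivAt (fun t : ℝ => J i (x + t • v)) (fderiv ℝ (J i) x v) 0 := by
    have h1 : HasFDerivAt (J i) (fderiv ℝ (J i) x) (x + (0 : ℝ) • v) := by
      simpa using ((hJ i).differentiable (by simp) x).hasFDerivAt
    have h2 : HasDerivAt (fun t : ℝ => x + t • v) v 0 := by
      simpa using ((hasDerivAt_id (0 : ℝ)).smul_const v).const_add x
    exact h1.comp_hasDerivAt (0 : ℝ) h2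
  have hmem : ∀ t : ℝ, x + t • v ∈ agentSlice i x := fun t c hc => by
    simp [v, hy c hc]
  have hc1 : ConvexOn ℝ univ (fun t : ℝ => J i (x + t • v)) := by
    refine ⟨convex_univ, fun s _ t _ a b ha hb hab => ?_⟩
    have := (hconv i x).2 (hmem s) (hmem t) ha hb hab
    convert this using 2
    rw [smul_add, smul_add, smul_smul, smul_smul, smul_eq_mul, smul_eq_mul, add_smul]
    have : x = a • x + b • x := by rw [← add_smul, hab, one_smul]
    nth_rewrite 1 [this]
    abel
  have := hc1.le_slope_of_hasDerivAt (mem_univ 0) (mem_univ 1) one_pos hd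
  rw [hdv, slope_def_field] at this
  simp only [zero_smul, add_zero, one_smul, sub_zero, div_one, sub_nonneg] at this
  simpa [v] using this

/-- A strongly monotone Lipschitz map on a Hilbert space has a zero. -/
theorem exists_eq_zero_of_stronglyMonotone {V : Type*} [NormedAddCommGroup V]
    [InnerProductSpace ℝ V] [CompleteSpace V] (F : V → V) (μ L : ℝ) (hμ : 0 < μ)
    (hmono : ∀ x y, μ * ‖x - y‖ ^ 2 ≤ inner ℝ (x - y) (F x - F y))
    (hLip : ∀ x y, ‖F x - F y‖ ≤ L * ‖x - y‖) : ∃ x, F x = 0 := by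
  -- The sign of L is not known, and M ≥ μ keeps 1 - μ² / M² nonnegative.
  set M := |L| + μ + 1 with hM
  have hM0 : 0 < M := by positivity
  have hML : ∀ x y, ‖F x - F y‖ ≤ M * ‖x - y‖ := fun x y => (hLip x y).trans
    (mul_le_mul_of_nonneg_right (by linarith [le_abs_self L]) (norm_nonneg _))
  -- This step length minimizes 1 - 2γμ + γ²M², the bound for the squared Lipschitz constant of x ↦
  -- x - γ F x.
  set γ := μ / M ^ 2
  have hγ : 0 < γ := by positivity
  have hq : 0 ≤ 1 - μ ^ 2 / M ^ 2 := by
    rw [sub_nonneg, div_le_one (by positivity)]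
    exact pow_le_pow_left₀ hμ.le (by linarith [abs_nonneg L]) 2
  have hq1 : Real.sqrt (1 - μ ^ 2 / M ^ 2) < 1 := by
    rw [Real.sqrt_lt' one_pos]
    have : 0 < μ ^ 2 / M ^ 2 := by positivity
    linarith
  have hK : ContractingWith (Real.toNNReal (Real.sqrt (1 - μ ^ 2 / M ^ 2)))
      (fun x => x - γ • F x) := by
    refine ⟨by simpa [← NNReal.coe_lt_coe, Real.coe_toNNReal _ (Real.sqrt_nonneg _)] using hq1, ?_⟩
    refine LipschitzWith.of_dist_le_mul fun x y => ?_
    rw [Real.coe_toNNReal _ (Real.sqrt_nonneg _), dist_eq_norm, dist_eq_norm]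
    have h : ‖x - γ • F x - (y - γ • F y)‖ ^ 2 ≤ (1 - μ ^ 2 / M ^ 2) * ‖x - y‖ ^ 2 := by
      have e : x - γ • F x - (y - γ • F y) = (x - y) - γ • (F x - F y) := by
        rw [smul_sub]; abel
      rw [e, norm_sub_sq_real, inner_smul_right, norm_smul, Real.norm_of_nonneg hγ.le, mul_pow]
      have h1 := hmono x y
      have h2 : ‖F x - F y‖ ^ 2 ≤ M ^ 2 * ‖x - y‖ ^ 2 := by
        rw [← mul_pow]; exact pow_le_pow_left₀ (norm_nonneg _) (hML x y) 2
      have h3 : γ ^ 2 * ‖F x - F y‖ ^ 2 ≤ γ ^ 2 * (M ^ 2 * ‖x - y‖ ^ 2) := by gcongr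
      have h4 : γ * (μ * ‖x - y‖ ^ 2) ≤ γ * inner ℝ (x - y) (F x - F y) := by gcongr
      have h5 : γ ^ 2 * (M ^ 2 * ‖x - y‖ ^ 2) = μ ^ 2 / M ^ 2 * ‖x - y‖ ^ 2 := by
        simp only [γ]; field_simp
      have h6 : γ * (μ * ‖x - y‖ ^ 2) = μ ^ 2 / M ^ 2 * ‖x - y‖ ^ 2 := by
        simp only [γ]; field_simp
      nlinarith
    have := Real.sqrt_le_sqrt h
    rwa [Real.sqrt_sq (norm_nonneg _), Real.sqrt_mul hq, Real.sqrt_sq (norm_nonneg _)] at this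
  refine ⟨hK.fixedPoint, ?_⟩
  have hfix : hK.fixedPoint - γ • F hK.fixedPoint = hK.fixedPoint := hK.fixedPoint_isFixedPt
  have h0 : γ • F hK.fixedPoint = 0 := by simpa using hfix
  exact (smul_eq_zero.mp h0).resolve_left hγ.ne'

theorem existsUnique_nash {N : ℕ} {m : Fin N → ℕ} {J : Fin N → Decision m → ℝ}
    (hJ : ∀ i, ContDiff ℝ 1 (J i)) (hconv : ∀ i x, ConvexOn ℝ (agentSlice i x) (J i))
    (μf L : ℝ) (hμf : 0 < μf)
    (hmono : ∀ x y : Decision m,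
      μf * ‖x - y‖ ^ 2 ≤ inner ℝ (x - y) (pseudogradient J x - pseudogradient J y))
    (hLip : ∀ x y : Decision m,
      ‖pseudogradient J x - pseudogradient J y‖ ≤ L * ‖x - y‖) :
    ∃ xs : Decision m, pseudogradient J xs = 0 ∧ ∀ x, IsNash J x ↔ x = xs := by
  obtain ⟨xs, hxs⟩ := exists_eq_zero_of_stronglyMonotone (pseudogradient J) μf L hμf hmono hLip
  refine ⟨xs, hxs, fun x => ⟨fun hx => ?_, fun hx => ?_⟩⟩
  · have h := hmono x xs
    rw [hx.pseudogradient_eq_zero hJ, hxs, sub_zero, inner_zero_right] at h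
    have h2 : ‖x - xs‖ ^ 2 ≤ 0 := by
      by_contra! hc
      nlinarith
    have h3 : ‖x - xs‖ = 0 := by
      have := sq_nonneg ‖x - xs‖
      exact pow_eq_zero_iff (two_ne_zero) |>.mp (le_antisymm h2 this)
    exact sub_eq_zero.mp (norm_eq_zero.mp h3)
  · rw [hx]
    exact isNash_of_pseudogradient_eq_zero hJ hconv hxs

/-! Sequences of sampling events -/

/-- The timers `τ k` and oscillators `μ k` just before the `k`-th sampling event, which is an event
of agent `e k` and happens at time `s k`; there are `n` events. -/
structure IsEventRun {N : ℕ} {m : Fin N → ℕ} (ω : Coord m → ℝ) (T : Fin N → ℝ) (n : ℕ)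
    (e : ℕ → Fin N) (s : ℕ → ℝ) (τ : ℕ → Timers N) (μ : ℕ → Oscillators m) : Prop where
  timer_mem : ∀ k ≤ n, ∀ i, τ k i ∈ Icc (0 : ℝ) 1
  active : ∀ k < n, ∀ i, τ k i = 1 ↔ e k = i
  timer_step : ∀ k < n, ∀ i, τ (k + 1) i = (if e k = i then 0 else τ k i) + (s (k + 1) - s k) / T i
  circ : ∀ k ≤ n, μ k ∈ circles m
  osc_step : ∀ k < n, ∀ q, μ (k + 1) q = if e k = q.1.1 then rotate ω (μ k) q else μ k q

/-- The number of events of agent `i` with index in `[u, v)`. -/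
def visits {N : ℕ} (e : ℕ → Fin N) (i : Fin N) (u v : ℕ) : ℕ :=
  ((Finset.Ico u v).filter (fun k => e k = i)).card

theorem visits_self {N : ℕ} (e : ℕ → Fin N) (i : Fin N) (u : ℕ) : visits e i u u = 0 := by
  simp [visits]

theorem visits_succ {N : ℕ} (e : ℕ → Fin N) (i : Fin N) {u v : ℕ} (h : u ≤ v) :
    visits e i u (v + 1) = visits e i u v + if e v = i then 1 else 0 := by
  unfold visits
  rw [← Finset.insert_Ico_right_eq_Ico_add_one h, Finset.filter_insert]
  split_ifs with hv
  · rw [Finset.card_insert_of_notMem (by simp)]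
  · simp

theorem sum_visits {N : ℕ} (e : ℕ → Fin N) (u v : ℕ) : ∑ i, visits e i u v = v - u := by
  unfold visits
  rw [← Finset.card_eq_sum_card_fiberwise (f := e) (t := Finset.univ) (by intro x _; simp)]
  simp

theorem visits_cons {N : ℕ} (e : ℕ → Fin N) (i : Fin N) {u v : ℕ} (h : u < v) :
    visits e i u v = visits e i (u + 1) v + if e u = i then 1 else 0 := by
  unfold visits
  rw [← Finset.insert_Ico_add_one_left_eq_Ico h, Finset.filter_insert]
  split_ifs with hv
  · rw [Finset.card_insert_of_notMem (by simp)]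
  · simp

/-- The oscillator of coordinate `c` as a complex number. -/
def phase {N : ℕ} {m : Fin N → ℕ} (μ : Oscillators m) (c : Coord m) : ℂ := ⟨μ (c, 0), μ (c, 1)⟩

theorem norm_phase {N : ℕ} {m : Fin N → ℕ} {μ : Oscillators m} (hμ : μ ∈ circles m) (c : Coord m) :
    ‖phase μ c‖ = 1 := by
  have := hμ c
  rw [Complex.norm_def, Complex.normSq_apply, phase]
  simp only
  rw [← sq, ← sq, this, Real.sqrt_one]

/-- Window sums of a sequence that is multiplied by `Q ≠ 1` over every period are bounded. -/
theorem norm_sum_Ico_le_of_quasiperiodic {w : ℕ → ℂ} {n R : ℕ} {Q : ℂ} (hQ : Q ≠ 1)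
    (hw : ∀ k ≤ n, ‖w k‖ ≤ 1) (hper : ∀ k, 1 ≤ k → k + R < n → w (k + R) = Q * w k)
    {u v : ℕ} (huv : u ≤ v) (hv : v ≤ n) :
    ‖∑ k ∈ Finset.Ico u v, w k‖ ≤ 2 * R / ‖1 - Q‖ + R + 1 := by
  have hQ0 : 0 < ‖1 - Q‖ := norm_pos_iff.mpr (sub_ne_zero.mpr hQ.symm)
  have triv : ∀ u v, u ≤ v → v ≤ n → ‖∑ k ∈ Finset.Ico u v, w k‖ ≤ (v : ℝ) - u := by
    intro u v huv hv
    refine (norm_sum_le_of_le _ fun k hk => hw k ?_).trans ?_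
    · have := Finset.mem_Ico.mp hk; omega
    · simp [Nat.cast_sub huv]
  have main : ∀ u v, 1 ≤ u → u ≤ v → v ≤ n →
      ‖∑ k ∈ Finset.Ico u v, w k‖ ≤ 2 * R / ‖1 - Q‖ + R := by
    intro u v hu huv hv
    by_cases hR : v ≤ u + R
    · refine (triv u v huv hv).trans ?_
      have : (v : ℝ) ≤ u + R := by exact_mod_cast hR
      have : 0 ≤ 2 * (R : ℝ) / ‖1 - Q‖ := by positivity
      linarith
    · push Not at hR
      obtain ⟨l, rfl⟩ := Nat.exists_eq_add_of_le hR.le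
      have e1 := Finset.sum_Ico_consecutive w (show u ≤ u + l by omega)
        (show u + l ≤ u + R + l by omega)
      have e2 := Finset.sum_Ico_consecutive w (show u ≤ u + R by omega)
        (show u + R ≤ u + R + l by omega)
      have e3 : ∑ k ∈ Finset.Ico (u + R) (u + R + l), w k = Q * ∑ k ∈ Finset.Ico u (u + l), w k := by
        rw [show u + R + l = u + l + R by omega, ← Finset.sum_Ico_add', Finset.mul_sum]
        refine Finset.sum_congr rfl fun k hk => ?_
        have := Finset.mem_Ico.mp hk
        exact hper k (by omega) (by omega)
      have t1 := triv u (u + R) (by omega) (by omega)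
      have t2 := triv (u + l) (u + R + l) (by omega) (by omega)
      push_cast at t1 t2
      -- Shifting the window by one period multiplies its sum by Q, and the two windows differ only
      -- in R terms at either end. Dividing by 1 - Q bounds the sum independently of its length.
      have e4 : (1 - Q) * ∑ k ∈ Finset.Ico u (u + l), w k
          = ∑ k ∈ Finset.Ico u (u + R), w k - ∑ k ∈ Finset.Ico (u + l) (u + R + l), w k := by
        linear_combination e1 - e2 + e3
      have e5 : ‖∑ k ∈ Finset.Ico u (u + l), w k‖ ≤ 2 * R / ‖1 - Q‖ := by
        rw [le_div_iff₀ hQ0, mul_comm, ← norm_mul, e4]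
        refine (norm_sub_le _ _).trans ?_
        linarith
      rw [← e1]
      refine (norm_add_le _ _).trans ?_
      linarith
  have hpos : 0 ≤ 2 * (R : ℝ) / ‖1 - Q‖ := by positivity
  -- Quasiperiodicity is only assumed from index 1 on; the term of index 0 accounts for the extra 1
  -- in the bound.
  rcases Nat.eq_zero_or_pos u with rfl | hu
  · rcases Nat.eq_zero_or_pos v with rfl | hv0
    · simp; positivity
    · rw [← Finset.sum_Ico_consecutive w (Nat.zero_le 1) hv0]
      refine (norm_add_le _ _).trans ?_
      have h1 := main 1 v le_rfl hv0 hv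
      have h2 := hw 0 (Nat.zero_le _)
      simp only [Nat.Ico_succ_singleton, Finset.sum_singleton] at *
      linarith
  · have := main u v hu huv hv
    linarith

namespace IsEventRun

variable {N : ℕ} {m : Fin N → ℕ} {ω : Coord m → ℝ} {T : Fin N → ℝ} {n : ℕ}
  {e : ℕ → Fin N} {s : ℕ → ℝ} {τ : ℕ → Timers N} {μ : ℕ → Oscillators m}

/-- A conservation law: each event of agent i takes its timer from 1 to 0, so timer plus number of
events grows exactly like elapsed time over T i. -/
theorem timer_eq (h : IsEventRun ω T n e s τ μ) (i : Fin N) {u v : ℕ} (huv : u ≤ v) (hv : v ≤ n) :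
    τ v i = τ u i + (s v - s u) / T i - visits e i u v := by
  induction v, huv using Nat.le_induction with
  | base => simp [visits_self]
  | succ v huv ih =>
    have h1 := ih (by omega)
    rw [h.timer_step v (by omega) i, visits_succ e i huv]
    have h2 := h.active v (by omega) i
    split_ifs with hv
    · rw [h2.mpr hv] at h1
      push_cast
      simp only [sub_div] at *
      linarith
    · push_cast
      simp only [sub_div] at *
      linarith

/-- The asymptotic frequency of the events of agent `i`. -/
def freq (T : Fin N → ℝ) (i : Fin N) : ℝ := (1 / T i) / ∑ u, 1 / T u

theorem freq_pos (hT : ∀ i, 0 < T i) (i : Fin N) : 0 < freq T i :=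
  div_pos (one_div_pos.mpr (hT i))
    (Finset.sum_pos (fun u _ => one_div_pos.mpr (hT u)) ⟨i, Finset.mem_univ i⟩)

theorem freq_le_one (hT : ∀ i, 0 < T i) (i : Fin N) : freq T i ≤ 1 := by
  have hS : 0 < ∑ u, 1 / T u :=
    Finset.sum_pos (fun u _ => one_div_pos.mpr (hT u)) ⟨i, Finset.mem_univ i⟩
  rw [freq, div_le_one hS]
  exact Finset.single_le_sum (f := fun u => 1 / T u) (fun u _ => (one_div_pos.mpr (hT u)).le)
    (Finset.mem_univ i)

/-- Summing `timer_eq` over all agents expresses the elapsed time through the total number v - u of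
events. Eliminating it leaves timer differences only: one for the agent itself and N from the sum.
-/
theorem abs_visits_sub_le (h : IsEventRun ω T n e s τ μ) (hT : ∀ i, 0 < T i) (i : Fin N) {u v : ℕ}
    (huv : u ≤ v) (hv : v ≤ n) :
    |(visits e i u v : ℝ) - ((v : ℝ) - u) * freq T i| ≤ 1 + N := by
  have hS : 0 < ∑ u, 1 / T u :=
    Finset.sum_pos (fun u _ => one_div_pos.mpr (hT u)) ⟨i, Finset.mem_univ i⟩
  have h1 : ∀ i, (visits e i u v : ℝ) = (s v - s u) * (1 / T i) + (τ u i - τ v i) := fun i => by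
    have := h.timer_eq i huv hv
    rw [div_eq_mul_one_div] at this
    linarith
  have hd : ∀ i, |τ u i - τ v i| ≤ 1 := fun i => by
    have a1 := h.timer_mem u (by omega) i
    have a2 := h.timer_mem v hv i
    rw [abs_le]
    constructor <;> linarith [a1.1, a1.2, a2.1, a2.2]
  have h2 : ((v : ℝ) - u) = (s v - s u) * (∑ i, 1 / T i) + ∑ i, (τ u i - τ v i) := by
    rw [Finset.mul_sum, ← Finset.sum_add_distrib, ← Finset.sum_congr rfl (fun i _ => h1 i),
      ← Nat.cast_sub huv, ← sum_visits e u v]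
    push_cast
    rfl
  have h3 : (visits e i u v : ℝ) - ((v : ℝ) - u) * freq T i
      = (τ u i - τ v i) - freq T i * ∑ i, (τ u i - τ v i) := by
    rw [h1 i, h2, add_mul, mul_assoc, freq, mul_div_cancel₀ _ hS.ne']
    ring
  rw [h3]
  refine (abs_sub _ _).trans (add_le_add (hd i) ?_)
  rw [abs_mul, abs_of_pos (freq_pos hT i)]
  refine (mul_le_mul (freq_le_one hT i) ?_ (abs_nonneg _) zero_le_one).trans (one_mul _).le
  refine (Finset.abs_sum_le_sum_abs _ _).trans ((Finset.sum_le_sum fun i _ => hd i).trans ?_)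
  simp

/-- A pigeonhole argument. Just after an event all timers lie in the half-open interval [0,1), so
the counts differ from `r i` by a term of the same sign for every agent (elapsed time against P)
plus a number in (-1,1). Being integers, they are all at least or all at most `r i`; the totals
agree, hence so do the counts. Because timers after a reset are used, the window starts at k + 1. -/
theorem visits_period (h : IsEventRun ω T n e s τ μ) (hT : ∀ i, 0 < T i) {r : Fin N → ℕ} {P : ℝ}
    (hr : ∀ i, r i * T i = P) {k : ℕ} (hk : k + (∑ i, r i) < n) (i : Fin N) :
    visits e i (k + 1) (k + 1 + ∑ i, r i) = r i := by
  set R := ∑ i, r i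
  have hσ : ∀ l < n, ∀ i, (if e l = i then 0 else τ l i) ∈ Ico (0 : ℝ) 1 := fun l hl i => by
    have h1 := h.timer_mem l hl.le i
    have h2 := h.active l hl i
    split_ifs with he
    · simp
    · exact ⟨h1.1, lt_of_le_of_ne h1.2 fun h3 => he (h2.mp h3)⟩
  have hv : ∀ l < n, ∀ i, (if e l = i then 0 else τ l i) = τ l i - if e l = i then 1 else 0 :=
    fun l hl i => by
    split_ifs with he
    · rw [(h.active l hl i).mpr he]; simp
    · simp
  have key : ∀ i, (visits e i (k + 1) (k + 1 + R) : ℝ) - r i = (s (k + R) - s k - P) / T i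
      + (if e k = i then 0 else τ k i) - (if e (k + R) = i then 0 else τ (k + R) i) := fun i => by
    rw [hv k (by omega), hv (k + R) hk, h.timer_eq i (show k ≤ k + R by omega) hk.le]
    have a1 := visits_cons e i (show k < k + R + 1 by omega)
    have a2 := visits_succ e i (show k ≤ k + R by omega)
    rw [show k + 1 + R = k + R + 1 by omega]
    have a3 : (visits e i (k + 1) (k + R + 1) : ℝ) + (if e k = i then 1 else 0)
        = visits e i k (k + R) + if e (k + R) = i then 1 else 0 := by
      have := a1.symm.trans a2
      exact_mod_cast this
    have a4 : (s (k + R) - s k - P) / T i = (s (k + R) - s k) / T i - r i := by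
      rw [← hr i, sub_div _ ((r i : ℝ) * T i), mul_div_cancel_right₀ _ (hT i).ne']
    rw [a4]
    linarith
  have hsum : ∑ i, visits e i (k + 1) (k + 1 + R) = ∑ i, r i := by
    rw [sum_visits]; omega
  rcases le_total 0 (s (k + R) - s k - P) with hs | hs
  · have hge : ∀ i ∈ Finset.univ, r i ≤ visits e i (k + 1) (k + 1 + R) := fun i _ => by
      have h1 := key i
      have h2 := (hσ k (by omega) i).1
      have h3 := (hσ (k + R) hk i).2
      have h4 : 0 ≤ (s (k + R) - s k - P) / T i := div_nonneg hs (hT i).le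
      have : (r i : ℝ) < visits e i (k + 1) (k + 1 + R) + 1 := by linarith
      have : r i < visits e i (k + 1) (k + 1 + R) + 1 := by exact_mod_cast this
      omega
    exact ((Finset.sum_eq_sum_iff_of_le hge).mp hsum.symm i (Finset.mem_univ i)).symm
  · have hge : ∀ i ∈ Finset.univ, visits e i (k + 1) (k + 1 + R) ≤ r i := fun i _ => by
      have h1 := key i
      have h2 := (hσ k (by omega) i).2
      have h3 := (hσ (k + R) hk i).1
      have h4 : (s (k + R) - s k - P) / T i ≤ 0 := div_nonpos_of_nonpos_of_nonneg hs (hT i).le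
      have : (visits e i (k + 1) (k + 1 + R) : ℝ) < r i + 1 := by linarith
      have : visits e i (k + 1) (k + 1 + R) < r i + 1 := by exact_mod_cast this
      omega
    exact (Finset.sum_eq_sum_iff_of_le hge).mp hsum i (Finset.mem_univ i)

/-- Two consecutive windows of length R contain equally many events of the agent `e k`. The event
lost at the left end must be regained at the right end. -/
theorem agent_period (h : IsEventRun ω T n e s τ μ) (hT : ∀ i, 0 < T i) {r : Fin N → ℕ} {P : ℝ}
    (hr : ∀ i, r i * T i = P) {k : ℕ} (hk1 : 1 ≤ k) (hk : k + (∑ i, r i) < n) :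
    e (k + ∑ i, r i) = e k := by
  obtain ⟨l, rfl⟩ := Nat.exists_eq_add_of_le' hk1
  set R := ∑ i, r i with hR
  have h1 := h.visits_period hT hr (k := l) (by omega) (e (l + 1))
  have h2 := h.visits_period hT hr (k := l + 1) (by omega) (e (l + 1))
  rw [← hR] at h1 h2
  have a1 := visits_cons e (e (l + 1)) (show l + 1 < l + 1 + R + 1 by omega)
  have a2 := visits_succ e (e (l + 1)) (show l + 1 ≤ l + 1 + R by omega)
  rw [show l + 1 + 1 + R = l + 1 + R + 1 by omega] at h2
  rw [h1] at a2
  rw [h2] at a1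
  by_contra hne
  rw [if_neg hne] at a2
  simp at a1
  omega

theorem phase_step (h : IsEventRun ω T n e s τ μ) {k : ℕ} (hk : k < n) (c : Coord m) :
    phase (μ (k + 1)) c
      = (if e k = c.1 then Complex.exp (ω c * Complex.I) else 1) * phase (μ k) c := by
  unfold phase
  rw [h.osc_step k hk, h.osc_step k hk]
  split_ifs with he
  · apply Complex.ext <;>
    simp [rotate, Complex.exp_ofReal_mul_I_re, Complex.exp_ofReal_mul_I_im]
    ring
  · simp

theorem phase_eq (h : IsEventRun ω T n e s τ μ) {u v : ℕ} (huv : u ≤ v) (hv : v ≤ n) (c : Coord m) :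
    phase (μ v) c = Complex.exp (ω c * Complex.I) ^ visits e c.1 u v * phase (μ u) c := by
  induction v, huv using Nat.le_induction with
  | base => simp [visits_self]
  | succ v huv ih =>
    rw [h.phase_step (by omega), ih (by omega), visits_succ e _ huv]
    split_ifs <;> ring

/-- Sums of powers of the phase of a coordinate over the events of its own agent are bounded. -/
theorem norm_sum_phase_pow_le (h : IsEventRun ω T n e s τ μ) (c : Coord m) (l : ℕ)
    (hne : Complex.exp (ω c * Complex.I) ^ l ≠ 1) {u v : ℕ} (huv : u ≤ v) (hv : v ≤ n) :
    ‖∑ k ∈ Finset.Ico u v, (if e k = c.1 then phase (μ k) c ^ l else 0)‖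
      ≤ 2 / ‖Complex.exp (ω c * Complex.I) ^ l - 1‖ := by
  have h0 : 0 < ‖Complex.exp (ω c * Complex.I) ^ l - 1‖ := norm_pos_iff.mpr (sub_ne_zero.mpr hne)
  rw [le_div_iff₀ h0, mul_comm, ← norm_mul, Finset.mul_sum]
  -- At an event of its own agent the l-th power of the phase is multiplied by exp(iω)^l, at all
  -- others it is unchanged. The terms are thus its increments, and the sum telescopes.
  have e1 : ∑ k ∈ Finset.Ico u v, (Complex.exp (ω c * Complex.I) ^ l - 1) *
      (if e k = c.1 then phase (μ k) c ^ l else 0) = phase (μ v) c ^ l - phase (μ u) c ^ l := by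
    rw [← Finset.sum_Ico_sub (fun k => phase (μ k) c ^ l) huv]
    refine Finset.sum_congr rfl fun k hk => ?_
    have := Finset.mem_Ico.mp hk
    rw [h.phase_step (by omega)]
    split_ifs <;> ring
  rw [e1]
  refine (norm_sub_le _ _).trans ?_
  rw [norm_pow, norm_pow, norm_phase (h.circ v hv), norm_phase (h.circ u (by omega))]
  norm_num

end IsEventRun

/-! ### Window sums of the dither signals and of their products -/

theorem exp_mul_I_ne_one {θ : ℝ} (h : ∀ z : ℤ, θ ≠ 2 * Real.pi * z) :
    Complex.exp (θ * Complex.I) ≠ 1 := by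
  intro h1
  obtain ⟨z, hz⟩ := Complex.exp_eq_one_iff.mp h1
  refine h z ?_
  have h2 := congrArg Complex.im hz
  simp at h2
  rw [h2]; ring

theorem exp_mul_I_pow (θ : ℝ) (n : ℕ) :
    Complex.exp (θ * Complex.I) ^ n = Complex.exp ((θ * n : ℝ) * Complex.I) := by
  rw [← Complex.exp_nat_mul]
  congr 1
  push_cast
  ring

namespace IsEventRun

variable {N : ℕ} {m : Fin N → ℕ} {ω : Coord m → ℝ} {T : Fin N → ℝ} {n : ℕ}
  {e : ℕ → Fin N} {s : ℕ → ℝ} {τ : ℕ → Timers N} {μ : ℕ → Oscillators m}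

theorem abs_sum_osc_le (h : IsEventRun ω T n e s τ μ) (c : Coord m)
    (hne : Complex.exp (ω c * Complex.I) ^ 1 ≠ 1) {u v : ℕ} (huv : u ≤ v) (hv : v ≤ n) :
    |∑ k ∈ Finset.Ico u v, (if e k = c.1 then μ k (c, 0) else 0)|
      ≤ 2 / ‖Complex.exp (ω c * Complex.I) ^ 1 - 1‖ := by
  refine le_trans ?_ (h.norm_sum_phase_pow_le c 1 hne huv hv)
  refine le_trans (le_of_eq ?_) (Complex.abs_re_le_norm _)
  rw [Complex.re_sum]
  congr 1
  refine Finset.sum_congr rfl fun k _ => ?_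
  split_ifs <;> simp [phase]

/-- On the unit circle the square of the real part of z is (1 + Re z²) / 2. The constant part counts
events, which gives the mean; the sum of Re z² is bounded by telescoping. -/
theorem abs_sum_osc_sq_le (h : IsEventRun ω T n e s τ μ) (hT : ∀ i, 0 < T i) (c : Coord m)
    (hne : Complex.exp (ω c * Complex.I) ^ 2 ≠ 1) {u v : ℕ} (huv : u ≤ v) (hv : v ≤ n) :
    |∑ k ∈ Finset.Ico u v, (if e k = c.1 then μ k (c, 0) * μ k (c, 0) else 0)
        - ((v : ℝ) - u) * freq T c.1 / 2|
      ≤ 2 / ‖Complex.exp (ω c * Complex.I) ^ 2 - 1‖ + (1 + N) := by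
  have h1 := (Complex.abs_re_le_norm _).trans (h.norm_sum_phase_pow_le c 2 hne huv hv)
  have h2 := h.abs_visits_sub_le hT c.1 huv hv
  rw [Complex.re_sum] at h1
  have h3 : ∑ k ∈ Finset.Ico u v, (if e k = c.1 then μ k (c, 0) * μ k (c, 0) else 0)
      = (∑ k ∈ Finset.Ico u v, (if e k = c.1 then phase (μ k) c ^ 2 else 0).re) / 2
        + visits e c.1 u v / 2 := by
    have : (visits e c.1 u v : ℝ) = ∑ k ∈ Finset.Ico u v, if e k = c.1 then 1 else 0 := by
      rw [visits, Finset.card_filter]; push_cast; rfl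
    rw [this, Finset.sum_div, Finset.sum_div, ← Finset.sum_add_distrib]
    refine Finset.sum_congr rfl fun k hk => ?_
    have hk := Finset.mem_Ico.mp hk
    have hc := h.circ k (by omega) c
    split_ifs
    · simp only [phase, sq, Complex.mul_re]
      nlinarith
    · simp
  rw [h3]
  rw [abs_le] at *
  constructor <;> linarith [h1.1, h1.2, h2.1, h2.2]

theorem phase_period (h : IsEventRun ω T n e s τ μ) (hT : ∀ i, 0 < T i) {r : Fin N → ℕ} {P : ℝ}
    (hr : ∀ i, r i * T i = P) {k : ℕ} (hk1 : 1 ≤ k) (hk : k + (∑ i, r i) ≤ n) (c : Coord m) :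
    phase (μ (k + ∑ i, r i)) c = Complex.exp ((ω c * r c.1 : ℝ) * Complex.I) * phase (μ k) c := by
  obtain ⟨l, rfl⟩ := Nat.exists_eq_add_of_le' hk1
  rw [h.phase_eq (Nat.le_add_right _ _) hk, h.visits_period hT hr (by omega), exp_mul_I_pow]

/-- The product of the real parts of z and w is half of Re(z w) + Re(z w̄). Restricted to the events
of one agent, both products are multiplied over R events by a fixed factor exp(i(ω r ± ω' r')),
which non-resonance keeps away from 1. Two coordinates of different agents rotate at different
events, so single-step telescoping is not available here. -/
theorem abs_sum_osc_mul_le (h : IsEventRun ω T n e s τ μ) (hT : ∀ i, 0 < T i) {r : Fin N → ℕ}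
    {P : ℝ} (hr : ∀ i, r i * T i = P) (c d : Coord m)
    (hp : Complex.exp ((ω c * r c.1 + ω d * r d.1 : ℝ) * Complex.I) ≠ 1)
    (hm : Complex.exp ((ω c * r c.1 - ω d * r d.1 : ℝ) * Complex.I) ≠ 1)
    {u v : ℕ} (huv : u ≤ v) (hv : v ≤ n) :
    |∑ k ∈ Finset.Ico u v, (if e k = c.1 then μ k (c, 0) * μ k (d, 0) else 0)|
      ≤ (2 * (∑ i, r i : ℕ) / ‖1 - Complex.exp ((ω c * r c.1 + ω d * r d.1 : ℝ) * Complex.I)‖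
          + (∑ i, r i : ℕ) + 1)
        + (2 * (∑ i, r i : ℕ) / ‖1 - Complex.exp ((ω c * r c.1 - ω d * r d.1 : ℝ) * Complex.I)‖
          + (∑ i, r i : ℕ) + 1) := by
  have hn : ∀ k < n, ‖phase (μ k) c‖ = 1 ∧ ‖phase (μ k) d‖ = 1 := fun k hk =>
    ⟨norm_phase (h.circ k hk.le) c, norm_phase (h.circ k hk.le) d⟩
  have b1 := norm_sum_Ico_le_of_quasiperiodic (n := n) (R := ∑ i, r i)
    (w := fun k => if e k = c.1 ∧ k < n then phase (μ k) c * phase (μ k) d else 0) hp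
    (fun k _ => by
      split_ifs with hk
      · rw [norm_mul, (hn k hk.2).1, (hn k hk.2).2, one_mul]
      · simp)
    (fun k hk1 hk => by
      rw [h.agent_period hT hr hk1 hk, h.phase_period hT hr hk1 hk.le,
        h.phase_period hT hr hk1 hk.le]
      have : k < n := by omega
      simp only [hk, this, and_true]
      split_ifs
      · push_cast
        rw [add_mul, Complex.exp_add]
        ring
      · simp) huv hv
  have b2 := norm_sum_Ico_le_of_quasiperiodic (n := n) (R := ∑ i, r i)
    (w := fun k => if e k = c.1 ∧ k < n then
      phase (μ k) c * (starRingEnd ℂ) (phase (μ k) d) else 0) hm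
    (fun k _ => by
      split_ifs with hk
      · rw [norm_mul, RCLike.norm_conj, (hn k hk.2).1, (hn k hk.2).2, one_mul]
      · simp)
    (fun k hk1 hk => by
      rw [h.agent_period hT hr hk1 hk, h.phase_period hT hr hk1 hk.le,
        h.phase_period hT hr hk1 hk.le]
      have : k < n := by omega
      simp only [hk, this, and_true]
      split_ifs
      · rw [map_mul, ← Complex.exp_conj, map_mul, Complex.conj_I, Complex.conj_ofReal,
          Complex.ofReal_sub, sub_mul, Complex.exp_sub, mul_neg, Complex.exp_neg]
        ring
      · simp) huv hv
  have c1 := (Complex.abs_re_le_norm _).trans b1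
  have c2 := (Complex.abs_re_le_norm _).trans b2
  rw [Complex.re_sum] at c1 c2
  have h3 : ∑ k ∈ Finset.Ico u v, (if e k = c.1 then μ k (c, 0) * μ k (d, 0) else 0)
      = (∑ k ∈ Finset.Ico u v, (if e k = c.1 ∧ k < n then phase (μ k) c * phase (μ k) d else 0).re
        + ∑ k ∈ Finset.Ico u v, (if e k = c.1 ∧ k < n then
            phase (μ k) c * (starRingEnd ℂ) (phase (μ k) d) else 0).re) / 2 := by
    rw [← Finset.sum_add_distrib, Finset.sum_div]
    refine Finset.sum_congr rfl fun k hk => ?_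
    have hk := Finset.mem_Ico.mp hk
    have : k < n := by omega
    simp only [this, and_true]
    split_ifs
    · simp only [phase, Complex.mul_re, Complex.conj_re, Complex.conj_im]
      ring
    · simp
  rw [h3]
  rw [abs_le] at *
  constructor <;> linarith [c1.1, c1.2, c2.1, c2.2]

end IsEventRun

/-- `C` bounds the deviation of window sums of the dither signals and of their products, over the
events of an agent, from their means. -/
def HasWindowBound {N : ℕ} {m : Fin N → ℕ} (ω : Coord m → ℝ) (T : Fin N → ℝ) (C : ℝ) : Prop :=
  ∀ (n : ℕ) (e : ℕ → Fin N) (s : ℕ → ℝ) (τ : ℕ → Timers N) (μ : ℕ → Oscillators m),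
    IsEventRun ω T n e s τ μ → ∀ u v, u ≤ v → v ≤ n →
    (∀ i, |(visits e i u v : ℝ) - ((v : ℝ) - u) * IsEventRun.freq T i| ≤ C) ∧
    (∀ c, |∑ k ∈ Finset.Ico u v, (if e k = c.1 then μ k (c, 0) else 0)| ≤ C) ∧
    ∀ c d, |∑ k ∈ Finset.Ico u v, (if e k = c.1 then μ k (c, 0) * μ k (d, 0) else 0)
      - (if c = d then ((v : ℝ) - u) * IsEventRun.freq T c.1 / 2 else 0)| ≤ C

/-- Window sums of the dither signals and of their products over the events of an agent deviate
from their means by a bounded amount. -/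
theorem exists_window_bound {N : ℕ} {m : Fin N → ℕ} (ω : Coord m → ℝ) (T : Fin N → ℝ)
    (hT : ∀ i, 0 < T i) (r : Fin N → ℕ) (P : ℝ) (hr : ∀ i, r i * T i = P)
    (hself : ∀ c, ∀ z : ℤ, ω c ≠ Real.pi * z)
    (hres : ∀ c d : Coord m, c ≠ d → ∀ z : ℤ,
      ω c * r c.1 + ω d * r d.1 ≠ 2 * Real.pi * z ∧
      ω c * r c.1 - ω d * r d.1 ≠ 2 * Real.pi * z) :
    ∃ C > 0, HasWindowBound ω T C := by
  have hne1 : ∀ c, Complex.exp (ω c * Complex.I) ^ 1 ≠ 1 := fun c => by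
    rw [pow_one]
    refine exp_mul_I_ne_one fun z hz => hself c (2 * z) ?_
    rw [hz]; push_cast; ring
  have hne2 : ∀ c, Complex.exp (ω c * Complex.I) ^ 2 ≠ 1 := fun c => by
    rw [exp_mul_I_pow]
    refine exp_mul_I_ne_one fun z hz => hself c z ?_
    push_cast at hz
    linarith
  set A : Coord m → ℝ := fun c => 2 / ‖Complex.exp (ω c * Complex.I) ^ 1 - 1‖ with hA
  set B : Coord m → ℝ := fun c => 2 / ‖Complex.exp (ω c * Complex.I) ^ 2 - 1‖ + (1 + N) with hB
  set D : Coord m → Coord m → ℝ := fun c d =>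
      (2 * (∑ i, r i : ℕ) / ‖1 - Complex.exp ((ω c * r c.1 + ω d * r d.1 : ℝ) * Complex.I)‖
          + (∑ i, r i : ℕ) + 1)
        + (2 * (∑ i, r i : ℕ) / ‖1 - Complex.exp ((ω c * r c.1 - ω d * r d.1 : ℝ) * Complex.I)‖
          + (∑ i, r i : ℕ) + 1) with hD
  have hA0 : ∀ c, 0 ≤ A c := fun c => by positivity
  have hB0 : ∀ c, 0 ≤ B c := fun c => by positivity
  have hD0 : ∀ c d, 0 ≤ D c d := fun c d => by positivity
  have sA : 0 ≤ ∑ c, A c := Finset.sum_nonneg fun c _ => hA0 c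
  have sB : 0 ≤ ∑ c, B c := Finset.sum_nonneg fun c _ => hB0 c
  have sD : 0 ≤ ∑ c, ∑ d, D c d := Finset.sum_nonneg fun c _ => Finset.sum_nonneg fun d _ => hD0 c d
  refine ⟨(1 + N) + ∑ c, A c + ∑ c, B c + ∑ c, ∑ d, D c d, by positivity, ?_⟩
  intro n e s τ μ h u v huv hv
  refine ⟨fun i => ?_, fun c => ?_, fun c d => ?_⟩
  · have := h.abs_visits_sub_le hT i huv hv
    linarith
  · have h1 := h.abs_sum_osc_le c (hne1 c) huv hv
    have h2 := Finset.single_le_sum (f := A) (fun c _ => hA0 c) (Finset.mem_univ c)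
    have : (0 : ℝ) ≤ 1 + N := by positivity
    linarith
  · have : (0 : ℝ) ≤ 1 + N := by positivity
    by_cases hcd : c = d
    · subst hcd
      rw [if_pos rfl]
      have h1 := h.abs_sum_osc_sq_le hT c (hne2 c) huv hv
      have h2 := Finset.single_le_sum (f := B) (fun c _ => hB0 c) (Finset.mem_univ c)
      linarith
    · rw [if_neg hcd, sub_zero]
      have h1 := h.abs_sum_osc_mul_le hT hr c d (exp_mul_I_ne_one fun z => (hres c d hcd z).1)
        (exp_mul_I_ne_one fun z => (hres c d hcd z).2) huv hv
      have h2 := Finset.single_le_sum (f := fun d => D c d) (fun d _ => hD0 c d) (Finset.mem_univ d)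
      have h3 := Finset.single_le_sum (f := fun c => ∑ d, D c d)
        (fun c _ => Finset.sum_nonneg fun d _ => hD0 c d) (Finset.mem_univ c)
      linarith

/-! From hybrid solutions to sequences of sampling events -/

theorem IsHybridTimeDomain.nonneg {S : Set (ℝ × ℕ)} (hS : IsHybridTimeDomain S) {t : ℝ} {j : ℕ}
    (h : (t, j) ∈ S) : 0 ≤ t := by
  obtain ⟨J, tt, h0, hm, heq⟩ := hS _ h
  have : ((0 : ℝ), 0) ∈ {q : ℝ × ℕ | q.2 ≤ J ∧ tt q.2 ≤ q.1 ∧ q.1 ≤ tt (q.2 + 1)} :=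
    ⟨Nat.zero_le _, h0.le, h0 ▸ hm (Nat.zero_le 1)⟩
  rw [← heq] at this
  exact this.2.2.1

theorem IsHybridTimeDomain.ordConnected {S : Set (ℝ × ℕ)} (hS : IsHybridTimeDomain S) {a b : ℝ}
    {j : ℕ} (ha : (a, j) ∈ S) (hb : (b, j) ∈ S) {c : ℝ} (hac : a ≤ c) (hcb : c ≤ b) :
    (c, j) ∈ S := by
  obtain ⟨J, tt, h0, hm, heq⟩ := hS _ hb
  have hmem : ∀ q : ℝ × ℕ, (q ∈ S ∧ 0 ≤ q.1 ∧ q.1 ≤ b ∧ q.2 ≤ j) ↔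
      (q.2 ≤ J ∧ tt q.2 ≤ q.1 ∧ q.1 ≤ tt (q.2 + 1)) := fun q => Set.ext_iff.mp heq q
  have h1 := (hmem (a, j)).mp ⟨ha, hS.nonneg ha, hac.trans hcb, le_rfl⟩
  have h2 := (hmem (b, j)).mp ⟨hb, hS.nonneg hb, le_rfl, le_rfl⟩
  exact ((hmem (c, j)).mpr ⟨h1.1, h1.2.1.trans hac, hcb.trans h2.2.2⟩).1

/-- The jump times before a point of a hybrid time domain. -/
theorem IsHybridTimeDomain.exists_times {S : Set (ℝ × ℕ)} (hS : IsHybridTimeDomain S) {t : ℝ}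
    {j : ℕ} (h : (t, j) ∈ S) : ∃ tt : ℕ → ℝ, tt 0 = 0 ∧ Monotone tt ∧ tt j ≤ t ∧
      (∀ k ≤ j, (tt k, k) ∈ S) ∧ ∀ k < j, (tt (k + 1), k) ∈ S := by
  obtain ⟨J, tt, h0, hm, heq⟩ := hS _ h
  have hmem : ∀ q : ℝ × ℕ, (q ∈ S ∧ 0 ≤ q.1 ∧ q.1 ≤ t ∧ q.2 ≤ j) ↔
      (q.2 ≤ J ∧ tt q.2 ≤ q.1 ∧ q.1 ≤ tt (q.2 + 1)) := fun q => Set.ext_iff.mp heq q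
  have h1 := (hmem (t, j)).mp ⟨h, hS.nonneg h, le_rfl, le_rfl⟩
  exact ⟨tt, h0, hm, h1.2.1,
    fun k hk => ((hmem (tt k, k)).mpr ⟨hk.trans h1.1, le_rfl, hm (Nat.le_succ k)⟩).1,
    fun k hk => ((hmem (tt (k + 1), k)).mpr ⟨hk.le.trans h1.1, hm (Nat.le_succ k), le_rfl⟩).1⟩

namespace HybridSystem.IsSolution

variable {E : Type*} [NormedAddCommGroup E] [NormedSpace ℝ E] {H : HybridSystem E}
  {dom : Set (ℝ × ℕ)} {φ : ℝ → ℕ → E}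

theorem Ioo_subset_interior (hφ : H.IsSolution dom φ) {a b : ℝ} {j : ℕ} (ha : (a, j) ∈ dom)
    (hb : (b, j) ∈ dom) : Ioo a b ⊆ interior {t | (t, j) ∈ dom} :=
  interior_maximal (fun _ hc => hφ.domain.ordConnected ha hb hc.1.le hc.2.le) isOpen_Ioo

/-- Solutions are affine during flows if the flow map is constant. -/
theorem flow_eq (hφ : H.IsSolution dom φ) {v : E} (hv : ∀ z, H.flowMap z = v) {a b : ℝ} {j : ℕ}
    (ha : (a, j) ∈ dom) (hb : (b, j) ∈ dom) (hab : a ≤ b) : φ b j = φ a j + (b - a) • v := by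
  have h1 : AbsolutelyContinuousOnInterval (fun t => φ t j - t • v) a b := by
    refine (hφ.absCont j a b ha hb).fun_sub ?_
    exact ContDiffOn.absolutelyContinuousOnInterval (by fun_prop)
  -- The flow equation is given only in the interior of the time interval; the endpoints form a null
  -- set.
  have h2 : ∀ᵐ t : ℝ, t ∈ uIcc a b → HasDerivAt (fun t => φ t j - t • v) 0 t := by
    have ea : ∀ᵐ t : ℝ, t ≠ a := by simp [ae_iff, measure_singleton]
    have eb : ∀ᵐ t : ℝ, t ≠ b := by simp [ae_iff, measure_singleton]
    filter_upwards [hφ.flow j, ea, eb] with t ht hta htb hmem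
    rw [uIcc_of_le hab] at hmem
    have := ht (hφ.Ioo_subset_interior ha hb
      ⟨lt_of_le_of_ne hmem.1 (Ne.symm hta), lt_of_le_of_ne hmem.2 htb⟩)
    rw [hv] at this
    simpa using this.fun_sub ((hasDerivAt_id' t).smul_const v)
  obtain ⟨C, hC⟩ := h1.const_of_ae_hasDerivAt_zero h2
  have h3 := (hC b right_mem_uIcc).trans (hC a left_mem_uIcc).symm
  rw [sub_smul]
  have h4 := sub_eq_iff_eq_add.mp h3
  rw [h4]
  abel

end HybridSystem.IsSolution

section Algorithm

variable {N : ℕ} {m : Fin N → ℕ}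

theorem mem_stateSet {X : Set (Decision m)} {𝒮 : Set (Timers N)} {z : AlgState m} :
    z ∈ stateSet X 𝒮 ↔ z.1 ∈ X ∧ z.2.2.1 ∈ circles m ∧ z.2.2.2.1 ∈ 𝒮 ∧
      (∀ i, ∃ n : ℕ, z.2.2.2.2.1 i = n) ∧ (∃ n : ℕ, z.2.2.2.2.2.1 = n) := Iff.rfl

theorem isClosed_circles : IsClosed (circles m) := by
  have : circles m = ⋂ c, {μ : Oscillators m | μ (c, 0) ^ 2 + μ (c, 1) ^ 2 = 1} := by
    ext μ; simp [circles]
  rw [this]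
  exact isClosed_iInter fun c => isClosed_eq (by fun_prop) (by fun_prop)

theorem isClosed_stateSet {𝒮 : Set (Timers N)} (h𝒮 : IsClosed 𝒮) :
    IsClosed (stateSet (m := m) univ 𝒮) := by
  have hN : IsClosed (range ((↑) : ℕ → ℝ)) := Nat.isClosedEmbedding_coe_real.isClosed_range
  have : stateSet (m := m) univ 𝒮 = {z : AlgState m | z.2.2.1 ∈ circles m} ∩
      ({z : AlgState m | z.2.2.2.1 ∈ 𝒮} ∩ ((⋂ i, {z : AlgState m | z.2.2.2.2.1 i ∈
        range ((↑) : ℕ → ℝ)}) ∩ {z : AlgState m | z.2.2.2.2.2.1 ∈ range ((↑) : ℕ → ℝ)})) := by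
    ext z
    simp only [mem_stateSet, mem_inter_iff, mem_iInter, mem_ofPred_eq, mem_univ, true_and, mem_range,
      eq_comm]
  rw [this]
  refine IsClosed.inter (isClosed_circles.preimage (by fun_prop))
    (IsClosed.inter (h𝒮.preimage (by fun_prop)) (IsClosed.inter (isClosed_iInter fun i => ?_)
      (hN.preimage (by fun_prop))))
  exact hN.preimage (by fun_prop)

/-- The other components of z are admissible already, so a nearest point replaces the decision only;
the product carries the maximum distance. -/
theorem infDist_stateSet {𝒮 : Set (Timers N)} {z : AlgState m} (hz : z ∈ stateSet univ 𝒮)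
    (xs : Decision m) : Metric.infDist z (stateSet {xs} 𝒮) = ‖z.1 - xs‖ := by
  have hmem : ((xs, z.2) : AlgState m) ∈ stateSet {xs} 𝒮 :=
    mem_stateSet.mpr ⟨rfl, (mem_stateSet.mp hz).2⟩
  refine le_antisymm ?_ ?_
  · refine (Metric.infDist_le_dist_of_mem hmem).trans (le_of_eq ?_)
    rw [Prod.dist_eq, dist_self, dist_eq_norm]
    exact max_eq_left (norm_nonneg _)
  · rw [Metric.le_infDist ⟨_, hmem⟩]
    intro y hy
    have : y.1 = xs := (mem_stateSet.mp hy).1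
    rw [← dist_eq_norm, ← this, Prod.dist_eq]
    exact le_max_left _ _

theorem rotate_mem_circles {ω : Coord m → ℝ} {μ : Oscillators m} (hμ : μ ∈ circles m)
    (S : Fin N → Prop) [DecidablePred S] :
    (WithLp.toLp 2 fun q => if S q.1.1 then rotate ω μ q else μ q : Oscillators m) ∈ circles m := by
  intro c
  have h := hμ c
  by_cases hc : S c.1
  · simp only [rotate, hc, if_true, Fin.isValue, one_ne_zero, if_false]
    have := Real.sin_sq_add_cos_sq (ω c)
    linear_combination (Real.sin (ω c) ^ 2 + Real.cos (ω c) ^ 2) * h + this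
  · simpa [hc] using h

variable {J : Fin N → Decision m → ℝ} {ω : Coord m → ℝ} {T : Fin N → ℝ} {𝒯 : Set (Timers N)}
  {α β : ℝ} {a : Coord m → ℝ} {dom : Set (ℝ × ℕ)} {φ : ℝ → ℕ → AlgState m}

theorem algJump_mem_stateSet (h𝒯 : IsTimerSet T 𝒯) {z : AlgState m}
    (hz : z ∈ stateSet univ {τ ∈ 𝒯 | ∃ i, τ i = 1}) : algJump J ω α a β z ∈ stateSet univ 𝒯 := by
  obtain ⟨-, h1, h2, h3, h4⟩ := mem_stateSet.mp hz
  refine mem_stateSet.mpr ⟨mem_univ _, ?_, h𝒯.jump_inv _ h2.1 h2.2, fun i => ?_, ?_⟩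
  · exact rotate_mem_circles h1 fun i => z.2.2.2.1 i = 1
  · obtain ⟨n, hn⟩ := h3 i
    simp only [algJump]
    split_ifs
    · exact ⟨n + 1, by rw [hn]; push_cast; rfl⟩
    · exact ⟨n, hn⟩
  · obtain ⟨n, hn⟩ := h4
    exact ⟨n + 1, by simp only [algJump]; rw [hn]; push_cast; rfl⟩

/-- A solution is required to stay in the flow set only in the interior of a flow interval.
Closedness of the set extends this to the right endpoint. -/
theorem flow_mem_stateSet (h𝒯 : IsTimerSet T 𝒯)
    (hφ : (zerothOrderAlgorithm J ω T 𝒯 α a β).IsSolution dom φ) {b c : ℝ} {j : ℕ}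
    (hb : (b, j) ∈ dom) (hc : (c, j) ∈ dom) (hbc : b ≤ c) (hz : φ b j ∈ stateSet univ 𝒯) :
    φ c j ∈ stateSet univ 𝒯 := by
  have hcl : IsClosed {r : ℝ | φ b j + (r - b) • algFlow T 0 ∈ stateSet univ 𝒯} :=
    (isClosed_stateSet h𝒯.closed).preimage (by fun_prop)
  have hfl : ∀ r, (r, j) ∈ dom → b ≤ r → φ r j = φ b j + (r - b) • algFlow T 0 := fun r hr hbr =>
    hφ.flow_eq (v := algFlow T 0) (fun _ => rfl) hb hr hbr
  rcases hbc.eq_or_lt with rfl | hlt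
  · exact hz
  have hsub : Ioo b c ⊆ {r : ℝ | φ b j + (r - b) • algFlow T 0 ∈ stateSet univ 𝒯} := fun r hr => by
    have h1 := hφ.flow_mem j r (hφ.Ioo_subset_interior hb hc hr)
    rw [hfl r (hφ.domain.ordConnected hb hc hr.1.le hr.2.le) hr.1.le] at h1
    exact h1
  have := hcl.closure_subset_iff.mpr hsub
  rw [closure_Ioo hlt.ne] at this
  rw [hfl c hc hbc]
  exact this ⟨hbc, le_rfl⟩

theorem init_mem_stateSet (h𝒯 : IsTimerSet T 𝒯)
    (hφ : (zerothOrderAlgorithm J ω T 𝒯 α a β).IsSolution dom φ) : φ 0 0 ∈ stateSet univ 𝒯 := by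
  rcases hφ.init with h | h
  · exact (isClosed_stateSet h𝒯.closed).closure_eq ▸ h
  · obtain ⟨h1, h2, h3, h4⟩ := mem_stateSet.mp h
    exact mem_stateSet.mpr ⟨h1, h2, h3.1, h4⟩

theorem mem_stateSet_of_mem_dom (h𝒯 : IsTimerSet T 𝒯)
    (hφ : (zerothOrderAlgorithm J ω T 𝒯 α a β).IsSolution dom φ) {t : ℝ} {j : ℕ}
    (ht : (t, j) ∈ dom) : φ t j ∈ stateSet univ 𝒯 := by
  obtain ⟨tt, h0, hm, hjt, hl, hr⟩ := hφ.domain.exists_times ht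
  have key : ∀ k ≤ j, φ (tt k) k ∈ stateSet univ 𝒯 := by
    intro k hk
    induction k with
    | zero => rw [h0]; exact init_mem_stateSet h𝒯 hφ
    | succ k _ =>
      obtain ⟨h1, h2⟩ := hφ.jump k (tt (k + 1)) (hr k hk) (hl (k + 1) hk)
      rw [h2]
      exact algJump_mem_stateSet h𝒯 h1
  exact flow_mem_stateSet h𝒯 hφ (hl j le_rfl) ht hjt (key j le_rfl)

/-- A solution, sampled just before its jumps and at the final time. -/
theorem exists_eventRun [Nonempty (Fin N)] (hT : ∀ i, 0 < T i) (h𝒯 : IsTimerSet T 𝒯)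
    (hφ : (zerothOrderAlgorithm J ω T 𝒯 α a β).IsSolution dom φ) {t : ℝ} {j : ℕ}
    (ht : (t, j) ∈ dom) :
    ∃ (e : ℕ → Fin N) (s : ℕ → ℝ) (τ : ℕ → Timers N) (μ : ℕ → Oscillators m)
      (x ξ : ℕ → Decision m), IsEventRun ω T j e s τ μ ∧
      (∀ k < j, ∀ c, x (k + 1) c = if e k = c.1 then x k c - α * β * ξ k c else x k c) ∧
      (∀ k < j, ∀ c, ξ (k + 1) c =
        if e k = c.1 then ξ k c + α * (gradEstimate J a (x k) (μ k) c - ξ k c) else ξ k c) ∧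
      x 0 = (φ 0 0).1 ∧ ξ 0 = (φ 0 0).2.1 ∧ x j = (φ t j).1 ∧ ∀ i, t ≤ T i * (j + 2) := by
  obtain ⟨tt, h0, hm, hjt, hl, hr⟩ := hφ.domain.exists_times ht
  -- Sample k is taken just before jump k, and sample j at the final time t, where no jump need
  -- happen.
  set s : ℕ → ℝ := fun k => if k < j then tt (k + 1) else t with hs
  have hsk : ∀ k < j, s k = tt (k + 1) := fun k hk => if_pos hk
  have hsj : s j = t := if_neg (lt_irrefl j)
  have hsd : ∀ k ≤ j, (s k, k) ∈ dom := fun k hk => by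
    rcases hk.lt_or_eq with h | rfl
    · rw [hsk k h]; exact hr k h
    · rw [hsj]; exact ht
  have hts : ∀ k ≤ j, tt k ≤ s k := fun k hk => by
    rcases hk.lt_or_eq with h | rfl
    · rw [hsk k h]; exact hm (Nat.le_succ k)
    · rw [hsj]; exact hjt
  set z : ℕ → AlgState m := fun k => φ (s k) k with hz
  have hfl : ∀ k ≤ j, z k = φ (tt k) k + (s k - tt k) • algFlow T 0 := fun k hk =>
    hφ.flow_eq (v := algFlow T 0) (fun _ => rfl) (hl k hk) (hsd k hk) (hts k hk)
  have hmem : ∀ k ≤ j, z k ∈ stateSet univ 𝒯 := fun k hk =>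
    mem_stateSet_of_mem_dom h𝒯 hφ (hsd k hk)
  have hjump : ∀ k < j, z k ∈ stateSet univ {τ ∈ 𝒯 | ∃ i, τ i = 1} ∧
      z (k + 1) = algJump J ω α a β (z k) + (s (k + 1) - s k) • algFlow T 0 := fun k hk => by
    obtain ⟨h1, h2⟩ := hφ.jump k (tt (k + 1)) (hr k hk) (hl (k + 1) hk)
    have h3 : z k = φ (tt (k + 1)) k := by simp only [hz]; rw [hsk k hk]
    refine ⟨h3 ▸ h1, ?_⟩
    rw [hfl (k + 1) hk, h2, h3, hsk k hk]
    rfl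
  -- Beyond the last jump the active agent is an arbitrary default.
  have hact : ∀ k, ∃ i, k < j → (z k).2.2.2.1 i = 1 := fun k => by
    by_cases hk : k < j
    · obtain ⟨i, hi⟩ := (mem_stateSet.mp (hjump k hk).1).2.2.1.2
      exact ⟨i, fun _ => hi⟩
    · exact ⟨Classical.arbitrary _, fun h => absurd h hk⟩
  choose e he using hact
  have hiff : ∀ k < j, ∀ i, (z k).2.2.2.1 i = 1 ↔ e k = i := fun k hk i =>
    ⟨fun h => h𝒯.no_concurrent _ (mem_stateSet.mp (hmem k hk.le)).2.2.1 _ _ (he k hk) h,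
      fun h => h ▸ he k hk⟩
  have hrun : IsEventRun ω T j e s (fun k => (z k).2.2.2.1) (fun k => (z k).2.2.1) :=
    { timer_mem := fun k hk i => h𝒯.mem_Icc _ (mem_stateSet.mp (hmem k hk)).2.2.1 i
      active := hiff
      timer_step := fun k hk i => by
        have h1 := congrArg (fun z : AlgState m => z.2.2.2.1 i) (hjump k hk).2
        simp only [← hiff k hk i]
        refine h1.trans ?_
        simp [algJump, algFlow, resetTimers, div_eq_mul_inv]
      circ := fun k hk => (mem_stateSet.mp (hmem k hk)).2.1
      osc_step := fun k hk q => by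
        have h1 := congrArg (fun z : AlgState m => z.2.2.1 q) (hjump k hk).2
        simp only [← hiff k hk q.1.1]
        refine h1.trans ?_
        simp [algJump, algFlow] }
  have hz0 : z 0 = φ 0 0 + s 0 • algFlow T 0 := by
    have := hfl 0 (Nat.zero_le _)
    rwa [h0, sub_zero] at this
  refine ⟨e, s, fun k => (z k).2.2.2.1, fun k => (z k).2.2.1, fun k => (z k).1,
    fun k => (z k).2.1, hrun, fun k hk c => ?_, fun k hk c => ?_, ?_, ?_, ?_, fun i => ?_⟩
  · have h1 := congrArg (fun z : AlgState m => z.1 c) (hjump k hk).2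
    simp only [← hiff k hk c.1]
    refine h1.trans ?_
    simp [algJump, algFlow]
  · have h1 := congrArg (fun z : AlgState m => z.2.1 c) (hjump k hk).2
    simp only [← hiff k hk c.1]
    refine h1.trans ?_
    simp [algJump, algFlow]
  · beta_reduce; rw [hz0]; simp [algFlow]
  · beta_reduce; rw [hz0]; simp [algFlow]
  · simp only [hz]; rw [hsj]
  -- The timer of agent i gains t / T i in total and loses 1 at each of at most j events, while it
  -- stays in [0,1]; this bounds t linearly in j.
  · have h1 := hrun.timer_eq i (Nat.zero_le j) le_rfl
    have h2 := (hrun.timer_mem j le_rfl i).2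
    have h3 : (z 0).2.2.2.1 i = (φ 0 0).2.2.2.1 i + s 0 / T i := by
      rw [hz0]; simp [algFlow, div_eq_mul_inv]
    have h4 := (h𝒯.mem_Icc _ (mem_stateSet.mp (init_mem_stateSet h𝒯 hφ)).2.2.1 i).1
    have h5 : visits e i 0 j ≤ j := by
      have := sum_visits e 0 j
      have h6 := Finset.single_le_sum (f := fun i => visits e i 0 j) (fun _ _ => Nat.zero_le _)
        (Finset.mem_univ i)
      omega
    have h7 : (visits e i 0 j : ℝ) ≤ j := by exact_mod_cast h5
    rw [h3, hsj, sub_div] at h1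
    have h8 : t / T i ≤ j + 2 := by linarith
    rw [div_le_iff₀ (hT i)] at h8
    linarith

end Algorithm

/-! Averaging of the gradient estimate -/

/-- A continuously differentiable function is uniformly differentiable on bounded sets. -/
theorem eventually_abs_sub_sub_fderiv_le {V : Type*} [NormedAddCommGroup V] [NormedSpace ℝ V]
    [ProperSpace V] {f : V → ℝ} (hf : ContDiff ℝ 1 f) (M : ℝ) {ε : ℝ} (hε : 0 < ε) :
    ∀ᶠ η in 𝓝[>] (0 : ℝ), ∀ x v : V, ‖x‖ ≤ M → ‖v‖ ≤ η →
      |f (x + v) - f x - fderiv ℝ f x v| ≤ ε * ‖v‖ := by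
  have hc : Continuous (fderiv ℝ f) := hf.continuous_fderiv (by simp)
  -- Radius M + 1 leaves room for increments of norm at most 1.
  have huc := (isCompact_closedBall (0 : V) (M + 1)).uniformContinuousOn_of_continuous hc.continuousOn
  obtain ⟨η, hη, hη2⟩ := Metric.uniformContinuousOn_iff_le.mp huc ε hε
  have h1 : ∀ᶠ r in 𝓝[>] (0 : ℝ), r ≤ min η 1 :=
    nhdsWithin_le_nhds (eventually_le_nhds (lt_min hη one_pos))
  filter_upwards [h1] with r hr x v hx hv
  have hconv : Convex ℝ (segment ℝ x (x + v)) := convex_segment _ _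
  have hseg : ∀ y ∈ segment ℝ x (x + v), ‖y - x‖ ≤ ‖v‖ := fun y hy => by
    obtain ⟨t, ht, rfl⟩ := (segment_eq_image' ℝ x (x + v)) ▸ hy
    simp only [add_sub_cancel_left, norm_smul, Real.norm_of_nonneg ht.1]
    exact mul_le_of_le_one_left (norm_nonneg _) ht.2
  have hb : ∀ y ∈ segment ℝ x (x + v), ‖fderiv ℝ f y - fderiv ℝ f x‖ ≤ ε := fun y hy => by
    have h2 := (hseg y hy).trans (hv.trans hr)
    rw [← dist_eq_norm]
    refine hη2 y ?_ x ?_ ?_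
    · rw [mem_closedBall_zero_iff]
      have : ‖y‖ ≤ ‖y - x‖ + ‖x‖ := by simpa using norm_add_le (y - x) x
      linarith [min_le_right η 1]
    · rw [mem_closedBall_zero_iff]; linarith
    · rw [dist_eq_norm]; exact h2.trans (min_le_left _ _)
  have := hconv.norm_image_sub_le_of_norm_hasFDerivWithin_le'
    (fun y _ => ((hf.differentiable (by simp) y).hasFDerivAt).hasFDerivWithinAt) hb
    (left_mem_segment ℝ x (x + v)) (right_mem_segment ℝ x (x + v))
  simpa using this

section

variable {N : ℕ} {m : Fin N → ℕ}

theorem norm_le_sum_abs {ι : Type*} [Fintype ι] (v : EuclideanSpace ℝ ι) : ‖v‖ ≤ ∑ c, |v c| := by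
  classical
  conv_lhs => rw [eq_sum_single v]
  refine (norm_sum_le _ _).trans (Finset.sum_le_sum fun c _ => ?_)
  simp [norm_smul]

theorem abs_osc_le_one {μ : Oscillators m} (hμ : μ ∈ circles m) (c : Coord m) : |μ (c, 0)| ≤ 1 := by
  have := hμ c
  rw [← sq_le_one_iff_abs_le_one]
  nlinarith [sq_nonneg (μ (c, 1))]

/-- Over long windows, the mean of the filtered gradient estimate of a coordinate is close to the
mean frequency of its events times the corresponding coordinate of the pseudogradient. -/
theorem exists_abs_sum_gradEstimate_sub_le (J : Fin N → Decision m → ℝ)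
    (hJ : ∀ i, ContDiff ℝ 1 (J i)) (ω : Coord m → ℝ) (T : Fin N → ℝ) (C : ℝ)
    (hC : HasWindowBound ω T C)
    (M ρ ε : ℝ) (hρ : 0 < ρ) (hε : 0 < ε) :
    ∃ as > 0, ∀ a : Coord m → ℝ, (∀ c, a c ∈ Ioo 0 as) → (∀ c d, a c ≤ ρ * a d) →
      ∃ K, ∀ (n : ℕ) (e : ℕ → Fin N) (s : ℕ → ℝ) (τ : ℕ → Timers N) (μ : ℕ → Oscillators m),
        IsEventRun ω T n e s τ μ → ∀ u v, u ≤ v → v ≤ n → ∀ x ξ : Decision m, ‖x‖ ≤ M → ‖ξ‖ ≤ M →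
        ∀ c, |∑ k ∈ Finset.Ico u v, (if e k = c.1 then gradEstimate J a x (μ k) c - ξ c else 0)
          - ((v : ℝ) - u) * (IsEventRun.freq T c.1 * (pseudogradient J x c - ξ c))|
          ≤ ε * ((v : ℝ) - u) + K := by
  set D : ℝ := ((Fintype.card (Coord m) : ℕ) : ℝ) with hD
  have hD0 : 0 ≤ D := Nat.cast_nonneg _
  -- The remainder is multiplied by 2 / a c, whereas the displacement is at most D ρ (a c); bounded
  -- amplitude ratios make the amplitude cancel.
  set ε₁ := ε / (2 * (D + 1) * ρ) with hε₁
  have hε₁0 : 0 < ε₁ := by positivity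
  obtain ⟨η, hη, hη0⟩ := ((Filter.eventually_all.mpr fun i =>
    eventually_abs_sub_sub_fderiv_le (hJ i) M hε₁0).and self_mem_nhdsWithin).exists
  replace hη0 : 0 < η := hη0
  have hJb : ∀ i, ∃ B, ∀ x ∈ Metric.closedBall (0 : Decision m) M, ‖J i x‖ ≤ B := fun i =>
    (isCompact_closedBall _ _).exists_bound_of_continuousOn (hJ i).continuous.continuousOn
  have hDb : ∀ i, ∃ B, ∀ x ∈ Metric.closedBall (0 : Decision m) M, ‖fderiv ℝ (J i) x‖ ≤ B := fun i =>
    (isCompact_closedBall _ _).exists_bound_of_continuousOn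
      ((hJ i).continuous_fderiv (by simp)).continuousOn
  choose BJ hBJ using hJb
  choose BD hBD using hDb
  -- The displacement has norm at most the sum of the D amplitudes, which then stays below η.
  refine ⟨η / (D + 1), by positivity, fun a ha hρa => ?_⟩
  -- This constant grows like the inverse amplitude. It does not depend on the window, so long
  -- windows make it negligible once the amplitudes are fixed.
  set K : Coord m → ℝ := fun c => C * (2 / a c * BJ c.1 + (∑ d, 2 / a c * a d * BD c.1) + M) with hK
  refine ⟨∑ c, |K c|, fun n e s τ μ h u v huv hv x ξ hx hξ c => ?_⟩
  obtain ⟨w1, w2, w3⟩ := hC n e s τ μ h u v huv hv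
  have hac : 0 < a c := (ha c).1
  have hxb : x ∈ Metric.closedBall (0 : Decision m) M := mem_closedBall_zero_iff.mpr hx
  set δ : ℕ → Decision m := fun k => dithered a x (μ k) - x with hδ
  have hδc : ∀ k d, δ k d = a d * μ k (d, 0) := fun k d => by simp [hδ, dithered]
  set rem : ℕ → ℝ := fun k => J c.1 (dithered a x (μ k)) - J c.1 x - fderiv ℝ (J c.1) x (δ k)
    with hrem
  have hδn : ∀ k ≤ n, ‖δ k‖ ≤ η ∧ ‖δ k‖ ≤ D * (ρ * a c) := fun k hk => by
    have h1 : ∀ d, |δ k d| ≤ a d := fun d => by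
      rw [hδc, abs_mul, abs_of_pos (ha d).1]
      exact mul_le_of_le_one_right (ha d).1.le (abs_osc_le_one (h.circ k hk) d)
    constructor
    · refine (norm_le_sum_abs _).trans ((Finset.sum_le_sum fun d _ =>
        (h1 d).trans (ha d).2.le).trans ?_)
      rw [Finset.sum_const, Finset.card_univ, nsmul_eq_mul, ← hD, mul_div_assoc',
        div_le_iff₀ (by positivity)]
      nlinarith
    · refine (norm_le_sum_abs _).trans ((Finset.sum_le_sum fun d _ =>
        (h1 d).trans (hρa d c)).trans ?_)
      rw [Finset.sum_const, Finset.card_univ, nsmul_eq_mul]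
  have hremb : ∀ k ≤ n, |2 / a c * rem k * μ k (c, 0)| ≤ ε := fun k hk => by
    have h1 := hη c.1 x (δ k) hx (hδn k hk).1
    rw [show x + δ k = dithered a x (μ k) by simp [hδ]] at h1
    rw [abs_mul, abs_mul, abs_of_pos (div_pos two_pos hac)]
    calc 2 / a c * |rem k| * |μ k (c, 0)| ≤ 2 / a c * |rem k| :=
          mul_le_of_le_one_right (by positivity) (abs_osc_le_one (h.circ k hk) c)
      _ ≤ 2 / a c * (ε₁ * (D * (ρ * a c))) := by
          gcongr
          exact h1.trans (mul_le_mul_of_nonneg_left (hδn k hk).2 hε₁0.le)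
      _ = ε * (D / (D + 1)) := by simp only [hε₁]; field_simp
      _ ≤ ε := mul_le_of_le_one_right hε.le (by rw [div_le_one (by positivity)]; linarith)
  have hterm : ∀ k, (if e k = c.1 then gradEstimate J a x (μ k) c - ξ c else 0)
      = 2 / a c * J c.1 x * (if e k = c.1 then μ k (c, 0) else 0)
        + (∑ d, 2 / a c * a d * fderiv ℝ (J c.1) x (EuclideanSpace.single d 1)
            * (if e k = c.1 then μ k (c, 0) * μ k (d, 0) else 0))
        + (if e k = c.1 then 2 / a c * rem k * μ k (c, 0) else 0)
        - ξ c * (if e k = c.1 then 1 else 0) := fun k => by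
    split_ifs with hk
    · have h1 : J c.1 (dithered a x (μ k)) = J c.1 x
          + (∑ d, a d * μ k (d, 0) * fderiv ℝ (J c.1) x (EuclideanSpace.single d 1)) + rem k := by
        simp only [hrem]
        rw [fderiv_apply_eq_sum]
        simp only [hδc]
        ring
      have h2 : ∑ d, 2 / a c * a d * fderiv ℝ (J c.1) x (EuclideanSpace.single d 1)
          * (μ k (c, 0) * μ k (d, 0)) = 2 / a c * μ k (c, 0)
            * ∑ d, a d * μ k (d, 0) * fderiv ℝ (J c.1) x (EuclideanSpace.single d 1) := by
        rw [Finset.mul_sum]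
        exact Finset.sum_congr rfl fun d _ => by ring
      rw [h2]
      simp only [gradEstimate]
      rw [h1]
      ring
    · simp
  have hvis : (visits e c.1 u v : ℝ) = ∑ k ∈ Finset.Ico u v, if e k = c.1 then 1 else 0 := by
    rw [visits, Finset.card_filter]; push_cast; rfl
  set S : Coord m → ℝ := fun d =>
    ∑ k ∈ Finset.Ico u v, (if e k = c.1 then μ k (c, 0) * μ k (d, 0) else 0) with hS
  set Z : Coord m → ℝ := fun d => if c = d then ((v : ℝ) - u) * IsEventRun.freq T c.1 / 2 else 0
    with hZ
  -- Only d = c has a nonzero mean: the factor 2 / a c cancels a c and the mean one half of the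
  -- squared dither.
  have hmean : ((v : ℝ) - u) * (IsEventRun.freq T c.1 * pseudogradient J x c)
      = ∑ d, 2 / a c * a d * fderiv ℝ (J c.1) x (EuclideanSpace.single d 1) * Z d := by
    simp only [hZ, mul_ite, mul_zero, Finset.sum_ite_eq, Finset.mem_univ, if_true, pseudogradient]
    field_simp
  have hdec : ∑ k ∈ Finset.Ico u v, (if e k = c.1 then gradEstimate J a x (μ k) c - ξ c else 0)
      - ((v : ℝ) - u) * (IsEventRun.freq T c.1 * (pseudogradient J x c - ξ c))
      = 2 / a c * J c.1 x * (∑ k ∈ Finset.Ico u v, if e k = c.1 then μ k (c, 0) else 0)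
        + (∑ d, 2 / a c * a d * fderiv ℝ (J c.1) x (EuclideanSpace.single d 1) * (S d - Z d))
        + (∑ k ∈ Finset.Ico u v, if e k = c.1 then 2 / a c * rem k * μ k (c, 0) else 0)
        - ξ c * ((visits e c.1 u v : ℝ) - ((v : ℝ) - u) * IsEventRun.freq T c.1) := by
    rw [Finset.sum_congr rfl fun k _ => hterm k, Finset.sum_sub_distrib, Finset.sum_add_distrib,
      Finset.sum_add_distrib, ← Finset.mul_sum, ← Finset.mul_sum, ← hvis, Finset.sum_comm]
    simp only [mul_sub, Finset.sum_sub_distrib]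
    simp only [← Finset.mul_sum]
    rw [hmean]
    ring
  rw [hdec]
  have t1 : |2 / a c * J c.1 x * (∑ k ∈ Finset.Ico u v, if e k = c.1 then μ k (c, 0) else 0)|
      ≤ 2 / a c * BJ c.1 * C := by
    rw [abs_mul, abs_mul, abs_of_pos (div_pos two_pos hac)]
    have h1 : |J c.1 x| ≤ BJ c.1 := hBJ c.1 x hxb
    have h2 := w2 c
    have h3 := (abs_nonneg _).trans h1
    gcongr
  have t2 : |∑ d, 2 / a c * a d * fderiv ℝ (J c.1) x (EuclideanSpace.single d 1) * (S d - Z d)|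
      ≤ (∑ d, 2 / a c * a d * BD c.1) * C := by
    rw [Finset.sum_mul]
    refine (Finset.abs_sum_le_sum_abs _ _).trans (Finset.sum_le_sum fun d _ => ?_)
    have had := (ha d).1
    have h1 : |fderiv ℝ (J c.1) x (EuclideanSpace.single d 1)| ≤ BD c.1 := by
      have := (fderiv ℝ (J c.1) x).le_opNorm (EuclideanSpace.single d 1)
      simp only [PiLp.norm_single, norm_one, mul_one] at this
      exact this.trans (hBD c.1 x hxb)
    have h2 := w3 c d
    have h3 := (abs_nonneg _).trans h1
    rw [abs_mul, abs_mul, abs_mul, abs_of_pos (div_pos two_pos hac), abs_of_pos had]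
    gcongr
  have t3 : |∑ k ∈ Finset.Ico u v, if e k = c.1 then 2 / a c * rem k * μ k (c, 0) else 0|
      ≤ ε * ((v : ℝ) - u) := by
    refine (Finset.abs_sum_le_sum_abs _ _).trans
      ((Finset.sum_le_sum (g := fun _ => ε) fun k hk => ?_).trans ?_)
    · split_ifs
      · exact hremb k (by have := Finset.mem_Ico.mp hk; omega)
      · simpa using hε.le
    · simp [Nat.cast_sub huv, mul_comm]
  have t4 : |ξ c * ((visits e c.1 u v : ℝ) - ((v : ℝ) - u) * IsEventRun.freq T c.1)| ≤ M * C := by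
    rw [abs_mul]
    have h1 : |ξ c| ≤ M := (PiLp.norm_apply_le ξ c).trans hξ
    have h2 := w1 c.1
    have h3 := (abs_nonneg _).trans h1
    gcongr
  have t5 : K c ≤ ∑ c, |K c| := (le_abs_self _).trans
    (Finset.single_le_sum (f := fun c => |K c|) (fun c _ => abs_nonneg _) (Finset.mem_univ c))
  have t6 : K c = 2 / a c * BJ c.1 * C + (∑ d, 2 / a c * a d * BD c.1) * C + M * C := by
    simp only [hK]; ring
  refine (abs_sub _ _).trans ?_
  refine (add_le_add_left ((abs_add_le _ _).trans (add_le_add_left (abs_add_le _ _) _)) _).trans ?_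
  linarith

end

/-! Averaging of the algorithm over blocks of events -/

section Block

variable {E : Type*} [NormedAddCommGroup E] [NormedSpace ℝ E] {f : ℕ → E → E} {z : ℕ → E}
  {α M B : ℝ} {n u l : ℕ}

/-- The bound B is valid in the ball of radius M + 1 only; the condition on α l B keeps the state in
that ball throughout the block, so the induction closes. -/
theorem norm_sub_le_of_step (hα : 0 ≤ α) (hz : ∀ k < n, z (k + 1) = z k + α • f k (z k))
    (hB0 : 0 ≤ B) (hB : ∀ k < n, ∀ y, ‖y‖ ≤ M + 1 → ‖f k y‖ ≤ B) (hu : ‖z u‖ ≤ M)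
    (hl : α * l * B ≤ 1) {k : ℕ} (huk : u ≤ k) (hkl : k ≤ u + l) (hkn : k ≤ n) :
    ‖z k - z u‖ ≤ α * ((k : ℝ) - u) * B := by
  induction k, huk using Nat.le_induction with
  | base => simp
  | succ k huk ih =>
    have h1 := ih (by omega) (by omega)
    have h2 : (k : ℝ) - u ≤ l := by
      have : (k : ℝ) ≤ u + l := by exact_mod_cast (by omega : k ≤ u + l)
      linarith
    have h3 : α * ((k : ℝ) - u) * B ≤ 1 := le_trans (by gcongr) hl
    have h4 : ‖z k‖ ≤ M + 1 := by
      have : ‖z k‖ ≤ ‖z k - z u‖ + ‖z u‖ := by simpa using norm_add_le (z k - z u) (z u)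
      linarith
    have h5 := hB k (by omega) _ h4
    rw [hz k (by omega), add_sub_right_comm]
    refine (norm_add_le _ _).trans ?_
    rw [norm_smul, Real.norm_of_nonneg hα]
    have h6 : α * ‖f k (z k)‖ ≤ α * B := by gcongr
    push_cast
    linarith

/-- Freezing the state at the start of the block costs at most ε per event, by uniform continuity of
the field. -/
theorem norm_block_sub_le (hα : 0 ≤ α) (hz : ∀ k < n, z (k + 1) = z k + α • f k (z k))
    (hB0 : 0 ≤ B) (hB : ∀ k < n, ∀ y, ‖y‖ ≤ M + 1 → ‖f k y‖ ≤ B) (hu : ‖z u‖ ≤ M)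
    (hl : α * l * B ≤ 1) {η ε : ℝ} (hη : α * l * B ≤ η)
    (hf : ∀ k < n, ∀ y y', ‖y‖ ≤ M + 1 → ‖y'‖ ≤ M + 1 → ‖y - y'‖ ≤ η → ‖f k y - f k y'‖ ≤ ε)
    (hul : u + l ≤ n) :
    ‖z (u + l) - z u - α • ∑ k ∈ Finset.Ico u (u + l), f k (z u)‖ ≤ α * l * ε := by
  have hsum : z (u + l) - z u = α • ∑ k ∈ Finset.Ico u (u + l), f k (z k) := by
    rw [← Finset.sum_Ico_sub z (Nat.le_add_right u l), Finset.smul_sum]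
    refine Finset.sum_congr rfl fun k hk => ?_
    have := Finset.mem_Ico.mp hk
    rw [hz k (by omega)]
    abel
  rw [hsum, ← smul_sub, ← Finset.sum_sub_distrib, norm_smul, Real.norm_of_nonneg hα, mul_assoc]
  refine mul_le_mul_of_nonneg_left ?_ hα
  refine (norm_sum_le_of_le (f := fun k => f k (z k) - f k (z u)) _ (n := fun _ => ε)
    fun k hk => ?_).trans ?_
  · have hk := Finset.mem_Ico.mp hk
    have h1 := norm_sub_le_of_step hα hz hB0 hB hu hl hk.1 hk.2.le (by omega)
    have h2 : α * ((k : ℝ) - u) * B ≤ α * l * B := by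
      have : (k : ℝ) ≤ u + l := by exact_mod_cast (by omega : k ≤ u + l)
      gcongr
      linarith
    refine hf k (by omega) _ _ ?_ (by linarith) (h1.trans (h2.trans hη))
    have : ‖z k‖ ≤ ‖z k - z u‖ + ‖z u‖ := by simpa using norm_add_le (z k - z u) (z u)
    linarith
  · simp

end Block

section

variable {N : ℕ} {m : Fin N → ℕ}

/-- Multiplication of the coordinates of a decision vector by weights. -/
def scale (w : Coord m → ℝ) : Decision m →ₗ[ℝ] Decision m where
  toFun v := WithLp.toLp 2 fun c => w c * v c
  map_add' v v' := by ext c; simp [mul_add]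
  map_smul' r v := by ext c; simp; ring

@[simp] theorem scale_apply (w : Coord m → ℝ) (v : Decision m) (c : Coord m) :
    scale w v c = w c * v c := rfl

theorem norm_scale_le {w : Coord m → ℝ} {b : ℝ} (hb : 0 ≤ b) (hw : ∀ c, |w c| ≤ b)
    (v : Decision m) : ‖scale w v‖ ≤ b * ‖v‖ := by
  refine le_of_sq_le_sq ?_ (by positivity)
  rw [mul_pow, EuclideanSpace.real_norm_sq_eq, EuclideanSpace.real_norm_sq_eq, Finset.mul_sum]
  refine Finset.sum_le_sum fun c _ => ?_
  rw [scale_apply, mul_pow]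
  refine mul_le_mul_of_nonneg_right ?_ (sq_nonneg _)
  rw [← sq_abs]
  exact pow_le_pow_left₀ (abs_nonneg _) (hw c) 2

/-- Runs of the algorithm, sampled at the events. -/
structure IsAlgRun (J : Fin N → Decision m → ℝ) (ω : Coord m → ℝ) (T : Fin N → ℝ) (α : ℝ)
    (a : Coord m → ℝ) (β : ℝ) (n : ℕ) (e : ℕ → Fin N) (s : ℕ → ℝ) (τ : ℕ → Timers N)
    (μ : ℕ → Oscillators m) (x ξ : ℕ → Decision m) : Prop extends IsEventRun ω T n e s τ μ where
  x_step : ∀ k < n, ∀ c, x (k + 1) c = if e k = c.1 then x k c - α * β * ξ k c else x k c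
  ξ_step : ∀ k < n, ∀ c, ξ (k + 1) c =
    if e k = c.1 then ξ k c + α * (gradEstimate J a (x k) (μ k) c - ξ k c) else ξ k c

/-- The increment of decisions and filters per unit of `α`, if all agents were active. -/
def fullField (J : Fin N → Decision m → ℝ) (a : Coord m → ℝ) (β : ℝ) (μ : Oscillators m)
    (z : Decision m × Decision m) : Decision m × Decision m :=
  (-β • z.2, gradEstimate J a z.1 μ - z.2)

/-- The increment of decisions and filters per unit of `α` at an event of agent `i`. -/
def eventField (J : Fin N → Decision m → ℝ) (a : Coord m → ℝ) (β : ℝ) (i : Fin N)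
    (μ : Oscillators m) (z : Decision m × Decision m) : Decision m × Decision m :=
  (scale (fun c => if i = c.1 then 1 else 0) (fullField J a β μ z).1,
    scale (fun c => if i = c.1 then 1 else 0) (fullField J a β μ z).2)

theorem norm_select_le (i : Fin N) (v : Decision m) :
    ‖scale (fun c => if i = c.1 then 1 else 0) v‖ ≤ ‖v‖ := by
  refine (norm_scale_le zero_le_one (fun c => ?_) v).trans (one_mul _).le
  split_ifs <;> simp

theorem norm_eventField_le (J : Fin N → Decision m → ℝ) (a : Coord m → ℝ) (β : ℝ) (i : Fin N)
    (μ : Oscillators m) (z : Decision m × Decision m) :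
    ‖eventField J a β i μ z‖ ≤ ‖fullField J a β μ z‖ :=
  max_le_max (norm_select_le i _) (norm_select_le i _)

theorem norm_eventField_sub_le (J : Fin N → Decision m → ℝ) (a : Coord m → ℝ) (β : ℝ) (i : Fin N)
    (μ : Oscillators m) (z z' : Decision m × Decision m) :
    ‖eventField J a β i μ z - eventField J a β i μ z'‖
      ≤ ‖fullField J a β μ z - fullField J a β μ z'‖ := by
  refine max_le_max ?_ ?_
  · exact (congrArg norm (map_sub _ _ _).symm).le.trans (norm_select_le i _)
  · exact (congrArg norm (map_sub _ _ _).symm).le.trans (norm_select_le i _)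

theorem isCompact_circles : IsCompact (circles m) := by
  refine Metric.isCompact_of_isClosed_isBounded isClosed_circles ?_
  refine (Metric.isBounded_closedBall (x := (0 : Oscillators m))
    (r := ∑ _ : Coord m × Fin 2, (1 : ℝ))).subset fun μ hμ => ?_
  rw [mem_closedBall_zero_iff]
  refine (norm_le_sum_abs μ).trans (Finset.sum_le_sum fun q _ => ?_)
  have := hμ q.1
  rw [← sq_le_one_iff_abs_le_one]
  obtain ⟨c, b⟩ := q
  fin_cases b
  · have h := sq_nonneg (μ (c, 1))
    simp only [Fin.zero_eta] at *
    linarith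
  · have h := sq_nonneg (μ (c, 0))
    simp only [Fin.mk_one] at *
    linarith

theorem continuous_fullField (J : Fin N → Decision m → ℝ) (hJ : ∀ i, Continuous (J i))
    (a : Coord m → ℝ) (β : ℝ) :
    Continuous fun y : (Decision m × Decision m) × Oscillators m => fullField J a β y.2 y.1 := by
  have h1 : Continuous fun y : (Decision m × Decision m) × Oscillators m =>
      dithered a y.1.1 y.2 := by
    unfold dithered
    fun_prop
  have h2 : Continuous fun y : (Decision m × Decision m) × Oscillators m =>
      gradEstimate J a y.1.1 y.2 := by
    unfold gradEstimate
    refine (PiLp.continuous_toLp 2 _).comp (continuous_pi fun c => ?_)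
    have := (hJ c.1).comp h1
    simp only [Function.comp_def] at this
    fun_prop
  unfold fullField
  fun_prop

theorem exists_fullField_bounds (J : Fin N → Decision m → ℝ) (hJ : ∀ i, Continuous (J i))
    (a : Coord m → ℝ) (β M : ℝ) {ε : ℝ} (hε : 0 < ε) :
    ∃ B ≥ 0, ∃ η > 0, ∀ μ ∈ circles m,
      (∀ z, ‖z‖ ≤ M → ‖fullField J a β μ z‖ ≤ B) ∧
      ∀ z z', ‖z‖ ≤ M → ‖z'‖ ≤ M → ‖z - z'‖ ≤ η →
        ‖fullField J a β μ z - fullField J a β μ z'‖ ≤ ε := by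
  have hK : IsCompact (Metric.closedBall (0 : Decision m × Decision m) M ×ˢ circles m) :=
    (isCompact_closedBall _ _).prod isCompact_circles
  have hc := continuous_fullField J hJ a β
  obtain ⟨B, hB⟩ := hK.exists_bound_of_continuousOn hc.continuousOn
  obtain ⟨η, hη, hη2⟩ := Metric.uniformContinuousOn_iff_le.mp
    (hK.uniformContinuousOn_of_continuous hc.continuousOn) ε hε
  refine ⟨|B|, abs_nonneg B, η, hη, fun μ hμ => ⟨fun z hz => ?_, fun z z' hz hz' hzz => ?_⟩⟩
  · exact (hB (z, μ) ⟨mem_closedBall_zero_iff.mpr hz, hμ⟩).trans (le_abs_self B)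
  · have := hη2 (z, μ) ⟨mem_closedBall_zero_iff.mpr hz, hμ⟩ (z', μ)
      ⟨mem_closedBall_zero_iff.mpr hz', hμ⟩ (by
        rw [Prod.dist_eq, dist_self, dist_eq_norm]
        exact max_le hzz hη.le)
    rwa [dist_eq_norm] at this

theorem IsAlgRun.step {J : Fin N → Decision m → ℝ} {ω : Coord m → ℝ} {T : Fin N → ℝ} {α : ℝ}
    {a : Coord m → ℝ} {β : ℝ} {n : ℕ} {e : ℕ → Fin N} {s : ℕ → ℝ} {τ : ℕ → Timers N}
    {μ : ℕ → Oscillators m} {x ξ : ℕ → Decision m} (h : IsAlgRun J ω T α a β n e s τ μ x ξ)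
    {k : ℕ} (hk : k < n) :
    (x (k + 1), ξ (k + 1)) = (x k, ξ k) + α • eventField J a β (e k) (μ k) (x k, ξ k) := by
  refine Prod.ext ?_ ?_
  · ext c
    change x (k + 1) c = x k c + α * ((if e k = c.1 then 1 else 0) * (-β * ξ k c))
    rw [h.x_step k hk c]
    split_ifs <;> ring
  · ext c
    change ξ (k + 1) c = ξ k c + α * ((if e k = c.1 then 1 else 0) *
      (gradEstimate J a (x k) (μ k) c - ξ k c))
    rw [h.ξ_step k hk c]
    split_ifs <;> ring

/-- Over a block of `l` events, the algorithm makes one Euler step of the averaged dynamics. -/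
theorem exists_block_averaging (J : Fin N → Decision m → ℝ)
    (hJ : ∀ i, ContDiff ℝ 1 (J i)) (ω : Coord m → ℝ) (T : Fin N → ℝ) (C : ℝ)
    (hC : HasWindowBound ω T C)
    (M ρ β ε h₀ : ℝ) (hρ : 0 < ρ) (hβ : 0 < β) (hε : 0 < ε) (hh₀ : 0 < h₀) :
    ∃ as > 0, ∀ a : Coord m → ℝ, (∀ c, a c ∈ Ioo 0 as) → (∀ c d, a c ≤ ρ * a d) →
      ∃ l : ℕ, 0 < l ∧ ∃ αs > 0, ∀ α ∈ Ioo 0 αs, α * l ≤ h₀ ∧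
        ∀ (n : ℕ) (e : ℕ → Fin N) (s : ℕ → ℝ) (τ : ℕ → Timers N) (μ : ℕ → Oscillators m)
          (x ξ : ℕ → Decision m), IsAlgRun J ω T α a β n e s τ μ x ξ →
          ∀ u, ‖x u‖ ≤ M → ‖ξ u‖ ≤ M →
          (u + l ≤ n →
            ‖x (u + l) - (x u - (α * l * β) • scale (fun c => IsEventRun.freq T c.1) (ξ u))‖
              ≤ α * l * ε ∧
            ‖ξ (u + l) - (ξ u + (α * l) • scale (fun c => IsEventRun.freq T c.1)
              (pseudogradient J (x u) - ξ u))‖ ≤ α * l * ε) ∧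
          ∀ k, u ≤ k → k ≤ u + l → k ≤ n → ‖x k - x u‖ ≤ ε := by
  set D : ℝ := ((Fintype.card (Coord m) : ℕ) : ℝ) with hD
  have hD0 : 0 ≤ D := Nat.cast_nonneg _
  -- Half of ε pays for freezing the state, the other half for averaging. The latter is shared by D
  -- coordinates, each with an error ε' l from the window sum and another ε' l from the bounded
  -- terms.
  set ε' := ε / (4 * (D + 1)) with hε'
  have hε'0 : 0 < ε' := by positivity
  obtain ⟨as, has, H⟩ := exists_abs_sum_gradEstimate_sub_le J hJ ω T C hC M ρ ε' hρ hε'0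
  refine ⟨as, has, fun a ha hρa => ?_⟩
  obtain ⟨K, hK⟩ := H a ha hρa
  obtain ⟨l, hl⟩ := exists_nat_ge ((|K| + |β * (M * C)|) / ε' + 1)
  obtain ⟨B, hB0, η, hη, hBη⟩ := exists_fullField_bounds J (fun i => (hJ i).continuous) a β (M + 1)
    (half_pos hε)
  have hdiv : 0 ≤ (|K| + |β * (M * C)|) / ε' := by positivity
  have hl0 : (0 : ℝ) < l := by linarith
  have hl1 : |K| + |β * (M * C)| ≤ ε' * l := by
    rw [mul_comm ε', ← div_le_iff₀ hε'0]; linarith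
  set w := min (min 1 η) (min ε h₀) with hw
  have hw0 : 0 < w := lt_min (lt_min one_pos hη) (lt_min hε hh₀)
  -- With B + 1 in place of B, the same choice bounds both α l B and α l by w.
  refine ⟨l, by exact_mod_cast hl0, w / (l * (B + 1)), by positivity, fun α hα => ?_⟩
  have hα0 := hα.1
  have hαw : α * l * (B + 1) ≤ w := by
    have := (lt_div_iff₀ (by positivity)).mp hα.2
    linarith
  have hαl : 0 ≤ α * l := by positivity
  have hαB : α * l * B ≤ w := by linarith
  have hα1 : α * l ≤ w := by
    have := mul_nonneg hαl hB0
    linarith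
  have hw1 : w ≤ 1 := (min_le_left _ _).trans (min_le_left _ _)
  have hw2 : w ≤ η := (min_le_left _ _).trans (min_le_right _ _)
  have hw3 : w ≤ ε := (min_le_right _ _).trans (min_le_left _ _)
  have hw4 : w ≤ h₀ := (min_le_right _ _).trans (min_le_right _ _)
  refine ⟨hα1.trans hw4, fun n e s τ μ x ξ h u hx hξ => ?_⟩
  obtain ⟨z, hz⟩ : ∃ z : ℕ → Decision m × Decision m, ∀ k, z k = (x k, ξ k) := ⟨_, fun _ => rfl⟩
  obtain ⟨f, hf⟩ : ∃ f : ℕ → Decision m × Decision m → Decision m × Decision m,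
    ∀ k, f k = eventField J a β (e k) (μ k) := ⟨_, fun _ => rfl⟩
  have hstep : ∀ k < n, z (k + 1) = z k + α • f k (z k) := fun k hk => by
    rw [hz, hz, hf]; exact h.step hk
  have hbd : ∀ k < n, ∀ y, ‖y‖ ≤ M + 1 → ‖f k y‖ ≤ B := fun k hk y hy => by
    rw [hf]
    exact (norm_eventField_le _ _ _ _ _ _).trans ((hBη _ (h.circ k hk.le)).1 y hy)
  have hu : ‖z u‖ ≤ M := by rw [hz]; exact max_le hx hξ
  refine ⟨fun hul => ?_, fun k huk hkl hkn => ?_⟩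
  · have hblock := norm_block_sub_le hα0.le hstep hB0 hbd hu (hαB.trans hw1) (hαB.trans hw2)
      (fun k hk y y' hy hy' hyy => by
        rw [hf]
        exact (norm_eventField_sub_le _ _ _ _ _ _ _).trans
          ((hBη _ (h.circ k hk.le)).2 y y' hy hy' hyy)) hul
    simp only [hz, hf] at hblock
    have hsmall : ∀ v : Decision m, (∀ c, |v c| ≤ 2 * ε' * l) → ‖v‖ ≤ l * (ε / 2) := fun v hv => by
      refine (norm_le_sum_abs v).trans ((Finset.sum_le_sum fun c _ => hv c).trans ?_)
      rw [Finset.sum_const, Finset.card_univ, nsmul_eq_mul, ← hD]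
      have : D * (2 * ε' * l) = l * (ε / 2) * (D / (D + 1)) := by
        simp only [hε']; field_simp; norm_num
      rw [this]
      exact mul_le_of_le_one_right (by positivity) (by rw [div_le_one (by positivity)]; linarith)
    set sx := (∑ k ∈ Finset.Ico u (u + l), eventField J a β (e k) (μ k) (x u, ξ u)).1 with hsx
    set sξ := (∑ k ∈ Finset.Ico u (u + l), eventField J a β (e k) (μ k) (x u, ξ u)).2 with hsξ
    have b1 : ‖x (u + l) - x u - α • sx‖ ≤ α * l * (ε / 2) := (le_max_left _ _).trans hblock
    have b2 : ‖ξ (u + l) - ξ u - α • sξ‖ ≤ α * l * (ε / 2) := (le_max_right _ _).trans hblock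
    have c1 : ‖sx + (l * β) • scale (fun c => IsEventRun.freq T c.1) (ξ u)‖ ≤ l * (ε / 2) := by
      refine hsmall _ fun c => ?_
      have e1 : sx c = - (β * ξ u c) * visits e c.1 u (u + l) := by
        rw [visits, Finset.card_filter]
        push_cast
        rw [Finset.mul_sum, hsx, Prod.fst_sum, WithLp.ofLp_sum, Finset.sum_apply]
        refine Finset.sum_congr rfl fun k _ => ?_
        by_cases hk : e k = c.1 <;> simp [eventField, fullField, hk]
      have e2 := ((hC n e s τ μ h.toIsEventRun u (u + l) (Nat.le_add_right _ _) hul).1 c.1)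
      have e3 : (sx + (l * β) • scale (fun c => IsEventRun.freq T c.1) (ξ u)) c
          = - (β * ξ u c) * (visits e c.1 u (u + l)
              - (((u + l : ℕ) : ℝ) - u) * IsEventRun.freq T c.1) := by
        simp only [PiLp.add_apply, PiLp.smul_apply, smul_eq_mul, scale_apply]
        rw [e1]
        push_cast
        ring
      rw [e3, abs_mul, abs_neg, abs_mul, abs_of_pos hβ]
      have e4 : |ξ u c| ≤ M := (PiLp.norm_apply_le (ξ u) c).trans hξ
      have e5 : β * |ξ u c| * |(visits e c.1 u (u + l) : ℝ)
          - (((u + l : ℕ) : ℝ) - u) * IsEventRun.freq T c.1| ≤ β * M * C := by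
        have := (abs_nonneg _).trans e4
        gcongr
      have e6 := le_abs_self (β * (M * C))
      have e7 := abs_nonneg K
      have e8 : 0 < ε' * l := by positivity
      linarith
    have c2 : ‖sξ - (l : ℝ) • scale (fun c => IsEventRun.freq T c.1)
        (pseudogradient J (x u) - ξ u)‖ ≤ l * (ε / 2) := by
      refine hsmall _ fun c => ?_
      have e1 : sξ c = ∑ k ∈ Finset.Ico u (u + l),
          (if e k = c.1 then gradEstimate J a (x u) (μ k) c - ξ u c else 0) := by
        rw [hsξ, Prod.snd_sum, WithLp.ofLp_sum, Finset.sum_apply]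
        refine Finset.sum_congr rfl fun k _ => ?_
        by_cases hk : e k = c.1 <;> simp [eventField, fullField, hk]
      have e2 := hK n e s τ μ h.toIsEventRun u (u + l) (Nat.le_add_right _ _) hul _ _ hx hξ c
      have e3 : (sξ - (l : ℝ) • scale (fun c => IsEventRun.freq T c.1)
          (pseudogradient J (x u) - ξ u)) c = sξ c - (((u + l : ℕ) : ℝ) - u) *
            (IsEventRun.freq T c.1 * (pseudogradient J (x u) c - ξ u c)) := by
        simp only [PiLp.sub_apply, PiLp.smul_apply, smul_eq_mul, scale_apply]
        push_cast
        ring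
      rw [e3, e1]
      refine e2.trans ?_
      have e6 := le_abs_self K
      have e7 := abs_nonneg (β * (M * C))
      push_cast
      linarith
    constructor
    · have : x (u + l) - (x u - (α * l * β) • scale (fun c => IsEventRun.freq T c.1) (ξ u))
          = (x (u + l) - x u - α • sx)
            + α • (sx + (l * β) • scale (fun c => IsEventRun.freq T c.1) (ξ u)) := by
        rw [smul_add, smul_smul, ← mul_assoc]
        abel
      rw [this]
      refine (norm_add_le _ _).trans ?_
      rw [norm_smul, Real.norm_of_nonneg hα0.le]
      have := mul_le_mul_of_nonneg_left c1 hα0.le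
      linarith
    · have : ξ (u + l) - (ξ u + (α * l) • scale (fun c => IsEventRun.freq T c.1)
            (pseudogradient J (x u) - ξ u))
          = (ξ (u + l) - ξ u - α • sξ)
            + α • (sξ - (l : ℝ) • scale (fun c => IsEventRun.freq T c.1)
              (pseudogradient J (x u) - ξ u)) := by
        rw [smul_sub α, smul_smul]
        abel
      rw [this]
      refine (norm_add_le _ _).trans ?_
      rw [norm_smul, Real.norm_of_nonneg hα0.le]
      have := mul_le_mul_of_nonneg_left c2 hα0.le
      linarith
  · have h1 := norm_sub_le_of_step hα0.le hstep hB0 hbd hu (hαB.trans hw1) huk hkl hkn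
    have h2 : α * ((k : ℝ) - u) * B ≤ α * l * B := by
      have : (k : ℝ) ≤ u + l := by exact_mod_cast hkl
      gcongr
      linarith
    rw [hz, hz] at h1
    exact (le_max_left _ _).trans (h1.trans (h2.trans (hαB.trans hw3)))

end

/-! Stability of the averaged dynamics -/

section

variable {N : ℕ} {m : Fin N → ℕ}

/-- The weighted distance of decisions to the equilibrium, plus `lam` times the distance of the
filters to the pseudogradient. -/
def lyapunov (F : Decision m → Decision m) (q : Coord m → ℝ) (xs : Decision m) (lam : ℝ)
    (x ξ : Decision m) : ℝ :=
  ‖scale (fun c => 1 / √(q c)) (x - xs)‖ + lam * ‖ξ - F x‖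

variable {F : Decision m → Decision m} {q : Coord m → ℝ} {q₀ μ L : ℝ} {xs : Decision m}

theorem norm_le_norm_scale (hq₀ : 0 < q₀) (hq : ∀ c, q₀ ≤ q c) (hq1 : ∀ c, q c ≤ 1)
    (v : Decision m) : ‖v‖ ≤ ‖scale (fun c => 1 / √(q c)) v‖ := by
  have h0 : ∀ c, 0 < √(q c) := fun c => Real.sqrt_pos.mpr (hq₀.trans_le (hq c))
  have h1 := norm_scale_le (w := fun c => √(q c)) zero_le_one (fun c => by
    rw [abs_of_pos (h0 c)]; exact Real.sqrt_le_one.mpr (hq1 c)) (scale (fun c => 1 / √(q c)) v)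
  rw [one_mul] at h1
  refine le_trans (le_of_eq ?_) h1
  congr 1
  ext c
  simp [(h0 c).ne']

theorem norm_scale_le_div (hq₀ : 0 < q₀) (hq : ∀ c, q₀ ≤ q c) (hq1 : ∀ c, q c ≤ 1)
    (v : Decision m) : ‖scale (fun c => 1 / √(q c)) v‖ ≤ 1 / q₀ * ‖v‖ := by
  refine norm_scale_le (by positivity) (fun c => ?_) v
  have hc := hq₀.trans_le (hq c)
  rw [abs_of_nonneg (by positivity)]
  have : q₀ ≤ √(q c) := (hq c).trans ((Real.le_sqrt' hc).mpr (by nlinarith [hq1 c]))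
  exact one_div_le_one_div_of_le hq₀ this

theorem sq_norm_scale_le (hq₀ : 0 < q₀) (hq : ∀ c, q₀ ≤ q c) (v : Decision m) :
    q₀ * ‖scale (fun c => 1 / √(q c)) v‖ ^ 2 ≤ ‖v‖ ^ 2 := by
  rw [EuclideanSpace.real_norm_sq_eq, EuclideanSpace.real_norm_sq_eq, Finset.mul_sum]
  refine Finset.sum_le_sum fun c _ => ?_
  have hc := hq₀.trans_le (hq c)
  rw [scale_apply, mul_pow, div_pow, Real.sq_sqrt hc.le, ← mul_assoc, one_pow, mul_one_div]
  exact mul_le_of_le_one_left (sq_nonneg _) ((div_le_one hc).mpr (hq c))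

/-- A small gradient step contracts the weighted distance to the equilibrium. -/
theorem norm_gradient_step_le (hq₀ : 0 < q₀) (hq : ∀ c, q₀ ≤ q c) (hq1 : ∀ c, q c ≤ 1)
    {η : ℝ} (hη : 0 < η) (hηL : η * L ^ 2 ≤ μ) (hημ : η * (μ * q₀ / 2) ≤ 1)
    {v g : Decision m} (hmono : μ * ‖v‖ ^ 2 ≤ inner ℝ v g) (hg : ‖g‖ ≤ L * ‖v‖) :
    ‖scale (fun c => 1 / √(q c)) v - η • scale (fun c => √(q c)) g‖
      ≤ (1 - η * (μ * q₀ / 2)) * ‖scale (fun c => 1 / √(q c)) v‖ := by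
  have h0 : ∀ c, 0 < √(q c) := fun c => Real.sqrt_pos.mpr (hq₀.trans_le (hq c))
  refine le_of_sq_le_sq ?_ (mul_nonneg (by linarith) (norm_nonneg _))
  -- This identity is why the weight is Q^(-1/2): strong monotonicity survives the different event
  -- frequencies of the agents.
  have hinner : inner ℝ (scale (fun c => 1 / √(q c)) v) (scale (fun c => √(q c)) g)
      = inner ℝ v g := by
    simp only [PiLp.inner_apply, scale_apply]
    refine Finset.sum_congr rfl fun c _ => ?_
    simp only [RCLike.inner_apply, conj_trivial]
    field_simp [(h0 c).ne']
  have hg2 : ‖scale (fun c => √(q c)) g‖ ^ 2 ≤ L ^ 2 * ‖v‖ ^ 2 := by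
    rw [← mul_pow]
    refine pow_le_pow_left₀ (norm_nonneg _) ?_ 2
    refine (norm_scale_le zero_le_one (fun c => ?_) g).trans ((one_mul _).le.trans hg)
    rw [abs_of_pos (h0 c)]
    exact Real.sqrt_le_one.mpr (hq1 c)
  rw [norm_sub_sq_real, inner_smul_right, hinner, norm_smul, Real.norm_of_nonneg hη.le, mul_pow,
    mul_pow]
  set U := ‖scale (fun c => 1 / √(q c)) v‖ ^ 2
  have hU : q₀ * U ≤ ‖v‖ ^ 2 := sq_norm_scale_le hq₀ hq v
  have hU0 : 0 ≤ U := by positivity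
  have hμ0 : 0 ≤ μ := le_trans (by positivity) hηL
  have e1 : η ^ 2 * ‖scale (fun c => √(q c)) g‖ ^ 2 ≤ η * (μ * ‖v‖ ^ 2) := by
    calc η ^ 2 * ‖scale (fun c => √(q c)) g‖ ^ 2 ≤ η ^ 2 * (L ^ 2 * ‖v‖ ^ 2) := by gcongr
      _ = η * (η * L ^ 2 * ‖v‖ ^ 2) := by ring
      _ ≤ η * (μ * ‖v‖ ^ 2) := by gcongr
  have e2 : η * (μ * ‖v‖ ^ 2) ≤ η * inner ℝ v g := by gcongr
  have e3 : η * (μ * (q₀ * U)) ≤ η * (μ * ‖v‖ ^ 2) := by gcongr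
  -- The squares contract by 1 - 2s with s = ημq₀/2, and 1 - 2s ≤ (1 - s)².
  have e4 : 0 ≤ (η * (μ * q₀ / 2)) ^ 2 * U := by positivity
  linarith

/-- One perturbed Euler step of the averaged dynamics decreases the Lyapunov function, up to the
perturbation. -/
theorem lyapunov_step (hq₀ : 0 < q₀) (hq : ∀ c, q₀ ≤ q c) (hq1 : ∀ c, q c ≤ 1)
    (hL : 0 < L) (hmono : ∀ x y, μ * ‖x - y‖ ^ 2 ≤ inner ℝ (x - y) (F x - F y))
    (hLip : ∀ x y, ‖F x - F y‖ ≤ L * ‖x - y‖) (hxs : F xs = 0)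
    {β h ε : ℝ} (hβ : 0 < β) (hβ1 : 8 * β * L ^ 2 ≤ q₀ * (μ * q₀ / 2)) (hβ2 : 4 * β * L ≤ q₀)
    (hβ3 : β * (μ * q₀ / 2) ≤ q₀) (hh : 0 < h) (hh1 : h ≤ 1) (hh2 : h * β * L ^ 2 ≤ μ)
    (hh3 : h * β * (μ * q₀ / 2) ≤ 1) {x ξ x' ξ' : Decision m}
    (hx : ‖x' - (x - (h * β) • scale q ξ)‖ ≤ h * ε)
    (hξ : ‖ξ' - (ξ + h • scale q (F x - ξ))‖ ≤ h * ε) :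
    lyapunov F q xs (4 * β / q₀) x' ξ'
      ≤ (1 - h * β * (μ * q₀ / 2) / 2) * lyapunov F q xs (4 * β / q₀) x ξ
        + h * ((1 / q₀ + 4 * β / q₀ * (1 + L)) * ε) := by
  have hqpos : ∀ c, 0 < q c := fun c => hq₀.trans_le (hq c)
  have h0 : ∀ c, 0 < √(q c) := fun c => Real.sqrt_pos.mpr (hqpos c)
  set X := scale (fun c => 1 / √(q c)) (x - xs) with hX
  set y := ξ - F x with hy
  set c₀ := μ * q₀ / 2 with hc₀
  have hqle : ∀ v : Decision m, ‖scale q v‖ ≤ ‖v‖ := fun v =>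
    (norm_scale_le zero_le_one (fun c => by rw [abs_of_pos (hqpos c)]; exact hq1 c) v).trans
      (one_mul _).le
  have hsle : ∀ v : Decision m, ‖scale (fun c => √(q c)) v‖ ≤ ‖v‖ := fun v =>
    (norm_scale_le zero_le_one (fun c => by
      rw [abs_of_pos (h0 c)]; exact Real.sqrt_le_one.mpr (hq1 c)) v).trans (one_mul _).le
  have hxX : ‖x - xs‖ ≤ ‖X‖ := norm_le_norm_scale hq₀ hq hq1 _
  have hFx : ‖F x‖ ≤ L * ‖x - xs‖ := by simpa [hxs] using hLip x xs
  have hgrad : ‖X - (h * β) • scale (fun c => √(q c)) (F x)‖ ≤ (1 - h * β * c₀) * ‖X‖ :=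
    norm_gradient_step_le hq₀ hq hq1 (by positivity) hh2 hh3
      (by simpa [hxs] using hmono x xs) hFx
  have hu : ‖scale (fun c => 1 / √(q c)) (x' - xs)‖
      ≤ (1 - h * β * c₀) * ‖X‖ + h * β * ‖y‖ + 1 / q₀ * (h * ε) := by
    have hdec : scale (fun c => 1 / √(q c)) (x' - xs)
        = (X - (h * β) • scale (fun c => √(q c)) (F x)) - (h * β) • scale (fun c => √(q c)) y
          + scale (fun c => 1 / √(q c)) (x' - (x - (h * β) • scale q ξ)) := by
      ext c
      simp only [hX, hy, scale_apply, PiLp.sub_apply, PiLp.add_apply, PiLp.smul_apply, smul_eq_mul]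
      have h2 : 1 / √(q c) * q c = √(q c) := by
        rw [one_div, inv_mul_eq_div, Real.div_sqrt]
      linear_combination (-(h * β * ξ c)) * h2
    rw [hdec]
    refine (norm_add_le _ _).trans (add_le_add ((norm_sub_le _ _).trans (add_le_add hgrad ?_)) ?_)
    · rw [norm_smul, Real.norm_of_nonneg (by positivity)]
      exact mul_le_mul_of_nonneg_left (hsle y) (by positivity)
    · exact (norm_scale_le_div hq₀ hq hq1 _).trans
        (mul_le_mul_of_nonneg_left hx (by positivity))
  have hξn : ‖ξ‖ ≤ ‖y‖ + L * ‖X‖ := by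
    have h1 : ‖ξ‖ ≤ ‖y‖ + ‖F x‖ := by simpa [hy] using norm_add_le (ξ - F x) (F x)
    have h2 : L * ‖x - xs‖ ≤ L * ‖X‖ := by gcongr
    linarith
  have hdx : ‖x - x'‖ ≤ h * β * (‖y‖ + L * ‖X‖) + h * ε := by
    have h1 : x - x' = (h * β) • scale q ξ - (x' - (x - (h * β) • scale q ξ)) := by abel
    rw [h1]
    refine (norm_sub_le _ _).trans (add_le_add ?_ hx)
    rw [norm_smul, Real.norm_of_nonneg (by positivity)]
    exact mul_le_mul_of_nonneg_left ((hqle ξ).trans hξn) (by positivity)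
  have hw : ‖ξ' - F x'‖ ≤ (1 - h * q₀) * ‖y‖ + h * ε
      + L * (h * β * (‖y‖ + L * ‖X‖) + h * ε) := by
    have hdec : ξ' - F x' = scale (fun c => 1 - h * q c) y
        + (ξ' - (ξ + h • scale q (F x - ξ))) + (F x - F x') := by
      ext c
      simp only [hy, scale_apply, PiLp.sub_apply, PiLp.add_apply, PiLp.smul_apply, smul_eq_mul]
      ring
    have hq₀1 : ∀ c, 0 ≤ 1 - h * q c := fun c => by
      have := mul_le_one₀ hh1 (hqpos c).le (hq1 c)
      linarith
    rw [hdec]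
    refine (norm_add_le _ _).trans (add_le_add ((norm_add_le _ _).trans (add_le_add ?_ hξ)) ?_)
    -- Nonnegativity of 1 - h q₀ is inferred from some coordinate; without coordinates all vectors
    -- are zero.
    · by_cases hne : Nonempty (Coord m)
      · obtain ⟨c₁⟩ := hne
        refine norm_scale_le ?_ (fun c => ?_) y
        · have := mul_le_mul_of_nonneg_left (hq c₁) hh.le
          linarith [hq₀1 c₁]
        · rw [abs_of_nonneg (hq₀1 c)]
          have := mul_le_mul_of_nonneg_left (hq c) hh.le
          linarith
      · have : IsEmpty (Coord m) := not_nonempty_iff.mp hne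
        have hy0 : ∀ v : Decision m, ‖v‖ = 0 := fun v => by
          rw [Subsingleton.elim v 0, norm_zero]
        rw [hy0, hy0, mul_zero]
    · exact (hLip x x').trans (mul_le_mul_of_nonneg_left hdx hL.le)
  unfold lyapunov
  rw [← hX, ← hy]
  set u := ‖X‖
  set w := ‖y‖
  have hu0 : 0 ≤ u := norm_nonneg _
  have hw0 : 0 ≤ w := norm_nonneg _
  set lam := 4 * β / q₀ with hlam
  have hlam0 : 0 < lam := by positivity
  have hlamq : lam * q₀ = 4 * β := by rw [hlam]; field_simp
  have hw' := mul_le_mul_of_nonneg_left hw hlam0.le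
  -- The budget: half of the decay of the decision error pays for the drift of F x caused by that
  -- error (`k1`, `k2`). The filter decay lam h q₀ w pays one quarter each for the drift caused by w
  -- (`k3`) and for the coupling h β w (`k5`, whence the 4 in lam), and one half for the required
  -- rate (`k4`).
  have k1 : lam * (L ^ 2) ≤ c₀ / 2 := by
    rw [hlam, div_mul_eq_mul_div, div_le_iff₀ hq₀]
    linarith
  have k2 : h * β * u * (lam * L ^ 2) ≤ h * β * u * (c₀ / 2) := by gcongr
  have k3 : lam * h * w * (4 * β * L) ≤ lam * h * w * q₀ := by gcongr
  have k4 : lam * h * w * (β * c₀) ≤ lam * h * w * q₀ := by gcongr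
  have k5 : h * β * w = h * w * (lam * q₀) / 4 := by rw [hlamq]; ring
  refine (add_le_add hu hw').trans ?_
  nlinarith

theorem norm_le_lyapunov (hq₀ : 0 < q₀) (hq : ∀ c, q₀ ≤ q c) (hq1 : ∀ c, q c ≤ 1) {lam : ℝ}
    (hlam : 0 ≤ lam) (x ξ : Decision m) : ‖x - xs‖ ≤ lyapunov F q xs lam x ξ :=
  (norm_le_norm_scale hq₀ hq hq1 _).trans (le_add_of_nonneg_right (by positivity))

/-- Sublevel sets must bound the filters for block averaging to apply. The bound degrades as lam
tends to 0, which is harmless because lam depends only on β and on q₀. -/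
theorem norm_filter_le_lyapunov (hq₀ : 0 < q₀) (hq : ∀ c, q₀ ≤ q c) (hq1 : ∀ c, q c ≤ 1)
    (hL : 0 ≤ L) (hLip : ∀ x y, ‖F x - F y‖ ≤ L * ‖x - y‖) (hxs : F xs = 0) {lam : ℝ}
    (hlam : 0 < lam) (x ξ : Decision m) :
    ‖ξ‖ ≤ lyapunov F q xs lam x ξ / lam + L * lyapunov F q xs lam x ξ := by
  have h1 : ‖ξ‖ ≤ ‖ξ - F x‖ + ‖F x‖ := by simpa using norm_add_le (ξ - F x) (F x)
  have h2 : ‖F x‖ ≤ L * ‖x - xs‖ := by simpa [hxs] using hLip x xs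
  have h3 := mul_le_mul_of_nonneg_left
    (norm_le_lyapunov (F := F) (xs := xs) hq₀ hq hq1 hlam.le x ξ) hL
  have h4 : ‖ξ - F x‖ ≤ lyapunov F q xs lam x ξ / lam := by
    rw [le_div_iff₀ hlam, mul_comm]
    exact le_add_of_nonneg_left (norm_nonneg _)
  linarith

/-- The initial filter error enters with the factor lam only, so for small β it is a small additive
term and the main term is linear in the initial decision error. -/
theorem lyapunov_init_le (hq₀ : 0 < q₀) (hq : ∀ c, q₀ ≤ q c) (hq1 : ∀ c, q c ≤ 1)
    (hL : 0 ≤ L) (hLip : ∀ x y, ‖F x - F y‖ ≤ L * ‖x - y‖) (hxs : F xs = 0) {lam δ : ℝ}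
    (hlam : 0 ≤ lam) {x ξ : Decision m} (hx : ‖x - xs‖ ≤ δ) (hξ : ‖ξ‖ ≤ δ) :
    lyapunov F q xs lam x ξ ≤ 1 / q₀ * ‖x - xs‖ + lam * ((1 + L) * δ) := by
  refine add_le_add (norm_scale_le_div hq₀ hq hq1 _) (mul_le_mul_of_nonneg_left ?_ hlam)
  have h2 : ‖F x‖ ≤ L * ‖x - xs‖ := by simpa [hxs] using hLip x xs
  have h3 : L * ‖x - xs‖ ≤ L * δ := by gcongr
  refine (norm_sub_le _ _).trans ?_
  linarith

end

/-! ### Practical stability, from the Lyapunov recursion to hybrid time -/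

theorem isClassKL_mul_exp {C c : ℝ} (hC : 0 < C) (hc : 0 < c) :
    IsClassKL fun r s => C * r * Real.exp (-(c * s)) where
  cont := by fun_prop
  zero := fun s _ => by simp
  strictMono := fun s _ x _ y _ hxy => by
    have := Real.exp_pos (-(c * s))
    beta_reduce
    gcongr
  anti := fun r hr x _ y _ hxy => by
    have hr : 0 ≤ r := hr
    beta_reduce
    gcongr
  tendsto := fun r _ => by
    have h1 : Tendsto (fun s : ℝ => c * s) atTop atTop := tendsto_id.const_mul_atTop hc
    simpa using (Real.tendsto_exp_neg_atTop_nhds_zero.comp h1).const_mul (C * r)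

/-- Linear recursions with a bounded perturbation, as long as the bound `S` is respected. -/
theorem le_pow_mul_add_of_step {V : ℕ → ℝ} {θ d S : ℝ} {n : ℕ} (hθ0 : 0 ≤ θ) (hθ1 : θ ≤ 1)
    (hd : 0 ≤ d) (h0 : 0 ≤ V 0) (hS : V 0 + d ≤ S)
    (hstep : ∀ i < n, V i ≤ S → V (i + 1) ≤ (1 - θ) * V i + θ * d) {i : ℕ} (hi : i ≤ n) :
    V i ≤ (1 - θ) ^ i * V 0 + d ∧ V i ≤ S := by
  induction i with
  | zero => simp; constructor <;> linarith
  | succ i ih =>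
    obtain ⟨h1, h2⟩ := ih (by omega)
    have h3 := hstep i (by omega) h2
    have h4 : (1 - θ) * V i ≤ (1 - θ) * ((1 - θ) ^ i * V 0 + d) :=
      mul_le_mul_of_nonneg_left h1 (by linarith)
    have h5 : V (i + 1) ≤ (1 - θ) ^ (i + 1) * V 0 + d := by
      rw [pow_succ]; linarith
    have h6 : (1 - θ) ^ (i + 1) * V 0 ≤ V 0 :=
      mul_le_of_le_one_left h0 (pow_le_one₀ (by linarith) (by linarith))
    exact ⟨h5, by linarith⟩

section

variable {N : ℕ} {m : Fin N → ℕ}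

/-- Practical stability of the sampled runs, in terms of the number of events. -/
theorem exists_run_bound [Nonempty (Fin N)] (J : Fin N → Decision m → ℝ)
    (hJ : ∀ i, ContDiff ℝ 1 (J i)) (μf L : ℝ) (hμf : 0 < μf) (hL : 0 < L)
    (hmono : ∀ x y : Decision m,
      μf * ‖x - y‖ ^ 2 ≤ inner ℝ (x - y) (pseudogradient J x - pseudogradient J y))
    (hLip : ∀ x y : Decision m, ‖pseudogradient J x - pseudogradient J y‖ ≤ L * ‖x - y‖)
    {xs : Decision m} (hxs : pseudogradient J xs = 0)
    (T : Fin N → ℝ) (hT : ∀ i, 0 < T i) (ω : Coord m → ℝ) (C : ℝ)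
    (hC : HasWindowBound ω T C) :
    ∃ A > 0, ∃ γ > 0, ∀ δ ν ρ : ℝ, 0 < ν → 0 < δ → 0 < ρ →
      ∃ βs > 0, ∀ β ∈ Ioo 0 βs, ∃ as > 0, ∀ a : Coord m → ℝ, (∀ c, a c ∈ Ioo 0 as) →
        (∀ c d, a c ≤ ρ * a d) → ∃ αs > 0, ∀ α ∈ Ioo 0 αs, α * β * γ ≤ 1 ∧
          ∀ (n : ℕ) (e : ℕ → Fin N) (s : ℕ → ℝ) (τ : ℕ → Timers N) (μ : ℕ → Oscillators m)
            (x ξ : ℕ → Decision m), IsAlgRun J ω T α a β n e s τ μ x ξ →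
            ‖x 0 - xs‖ ≤ δ → ‖ξ 0‖ ≤ δ →
            ‖x n - xs‖ ≤ A * ‖x 0 - xs‖ * Real.exp (-(α * β * γ * n)) + ν := by
  obtain ⟨i₀, hi₀⟩ := Finite.exists_min (IsEventRun.freq T)
  set q₀ := IsEventRun.freq T i₀
  have hq₀ : 0 < q₀ := IsEventRun.freq_pos hT i₀
  set q : Coord m → ℝ := fun c => IsEventRun.freq T c.1 with hqdef
  have hq : ∀ c, q₀ ≤ q c := fun c => hi₀ c.1
  have hq1 : ∀ c, q c ≤ 1 := fun c => IsEventRun.freq_le_one hT c.1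
  have hq₀1 : q₀ ≤ 1 := IsEventRun.freq_le_one hT i₀
  set c₀ := μf * q₀ / 2 with hc₀
  have hc₀0 : 0 < c₀ := by positivity
  refine ⟨Real.exp 1 / q₀, by positivity, c₀ / 2, by positivity, fun δ ν ρ hν hδ hρ => ?_⟩
  -- Three errors of size d occur: the initial filter error, the accumulated perturbation, and the
  -- drift in the last incomplete block.
  set d := ν / 4 with hd
  have hd0 : 0 < d := by positivity
  -- The first three terms are the conditions on β in `lyapunov_step`; the fourth makes the initial
  -- filter error at most d.
  set βs := min (min (q₀ * c₀ / (8 * L ^ 2)) (q₀ / (4 * L)))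
    (min (q₀ / c₀) (d * q₀ / (4 * ((1 + L) * δ)))) with hβs
  refine ⟨βs, by positivity, fun β hβ => ?_⟩
  have hβ0 : 0 < β := hβ.1
  have hβ1 : 8 * β * L ^ 2 ≤ q₀ * c₀ := by
    have := (le_div_iff₀ (by positivity)).mp
      (hβ.2.le.trans ((min_le_left _ _).trans (min_le_left _ _)))
    linarith
  have hβ2 : 4 * β * L ≤ q₀ := by
    have := (le_div_iff₀ (by positivity)).mp
      (hβ.2.le.trans ((min_le_left _ _).trans (min_le_right _ _)))
    linarith
  have hβ3 : β * c₀ ≤ q₀ := (le_div_iff₀ (by positivity)).mp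
    (hβ.2.le.trans ((min_le_right _ _).trans (min_le_left _ _)))
  have hβ4 : 4 * β / q₀ * ((1 + L) * δ) ≤ d := by
    have := (le_div_iff₀ (by positivity)).mp
      (hβ.2.le.trans ((min_le_right _ _).trans (min_le_right _ _)))
    rw [div_mul_eq_mul_div, div_le_iff₀ hq₀]
    linarith
  set lam := 4 * β / q₀ with hlam
  have hlam0 : 0 < lam := by positivity
  set S := 1 / q₀ * δ + 2 * d with hS
  have hS0 : 0 < S := by positivity
  set M := ‖xs‖ + S + S / lam + L * S with hM
  -- The second term makes the perturbation of a block at most θ d, with θ the relative decay per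
  -- block.
  set ε := min d (β * c₀ / 2 * d / (1 / q₀ + lam * (1 + L))) with hε
  have hε0 : 0 < ε := lt_min hd0 (by positivity)
  have hεd : ε ≤ d := min_le_left _ _
  have hεS : (1 / q₀ + lam * (1 + L)) * ε ≤ β * c₀ / 2 * d := by
    rw [mul_comm]
    exact (le_div_iff₀ (by positivity)).mp (min_le_right _ _)
  set h₀ := min 1 (min (μf / (β * L ^ 2)) (1 / (β * c₀))) with hh₀
  have hh₀0 : 0 < h₀ := lt_min one_pos (lt_min (by positivity) (by positivity))
  obtain ⟨as, has, H⟩ := exists_block_averaging J hJ ω T C hC M ρ β ε h₀ hρ hβ0 hε0 hh₀0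
  refine ⟨as, has, fun a ha hρa => ?_⟩
  obtain ⟨l, hl0, αs, hαs, H⟩ := H a ha hρa
  refine ⟨αs, hαs, fun α hα => ?_⟩
  have hα0 := hα.1
  obtain ⟨hαl, H⟩ := H α hα
  have hl0' : (1 : ℝ) ≤ l := by exact_mod_cast hl0
  set h := α * l with hh
  have hhpos : 0 < h := by positivity
  have hαh : α ≤ h := le_mul_of_one_le_right hα0.le hl0'
  have hh1 : h ≤ 1 := hαl.trans (min_le_left _ _)
  have hh2 : h * β * L ^ 2 ≤ μf := by
    have := (le_div_iff₀ (by positivity)).mp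
      (hαl.trans ((min_le_right _ _).trans (min_le_left _ _)))
    linarith
  have hh3 : h * β * c₀ ≤ 1 := by
    have := (le_div_iff₀ (by positivity)).mp
      (hαl.trans ((min_le_right _ _).trans (min_le_right _ _)))
    linarith
  refine ⟨?_, fun n e s τ μ x ξ hrun hx0 hξ0 => ?_⟩
  · have : α * β * c₀ ≤ h * β * c₀ := by gcongr
    have : 0 < α * β * c₀ := by positivity
    linarith
  set V : ℕ → ℝ := fun i => lyapunov (pseudogradient J) q xs lam (x (i * l)) (ξ (i * l)) with hV
  set θ := h * β * c₀ / 2 with hθ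
  have hθ0 : 0 < θ := by positivity
  have hθ1 : θ ≤ 1 := by linarith
  have hV0 : V 0 ≤ 1 / q₀ * ‖x 0 - xs‖ + d := by
    have := lyapunov_init_le (F := pseudogradient J) hq₀ hq hq1 hL.le hLip hxs hlam0.le hx0 hξ0
    simp only [hV, zero_mul]
    linarith
  have hV0S : V 0 + d ≤ S := by
    have : 1 / q₀ * ‖x 0 - xs‖ ≤ 1 / q₀ * δ := by gcongr
    linarith
  have hball : ∀ i, V i ≤ S → ‖x (i * l)‖ ≤ M ∧ ‖ξ (i * l)‖ ≤ M := fun i hi => by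
    have h1 := norm_le_lyapunov (F := pseudogradient J) (xs := xs) hq₀ hq hq1 hlam0.le
      (x (i * l)) (ξ (i * l))
    have h2 := norm_filter_le_lyapunov (F := pseudogradient J) (xs := xs) hq₀ hq hq1 hL.le hLip
      hxs hlam0 (x (i * l)) (ξ (i * l))
    have h3 : ‖x (i * l)‖ ≤ ‖x (i * l) - xs‖ + ‖xs‖ := by
      simpa using norm_add_le (x (i * l) - xs) xs
    have h4 : V i / lam ≤ S / lam := by gcongr
    have h5 : L * V i ≤ L * S := by gcongr
    have h6 : 0 ≤ S / lam := by positivity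
    have h7 : 0 ≤ L * S := by positivity
    have h8 := norm_nonneg xs
    simp only [hV] at hi h4 h5
    constructor <;> linarith
  have hstep : ∀ i < n / l, V i ≤ S → V (i + 1) ≤ (1 - θ) * V i + θ * d := fun i hi hVi => by
    obtain ⟨hxM, hξM⟩ := hball i hVi
    have hil : i * l + l ≤ n := by
      have := Nat.mul_le_of_le_div l (i + 1) n hi
      linarith
    obtain ⟨b1, b2⟩ := (H n e s τ μ x ξ hrun (i * l) hxM hξM).1 hil
    have key := lyapunov_step (F := pseudogradient J) hq₀ hq hq1 hL hmono hLip hxs hβ0 hβ1 hβ2 hβ3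
      hhpos hh1 hh2 hh3 b1 b2
    rw [← hlam, ← hc₀] at key
    have h1 := mul_le_mul_of_nonneg_left hεS hhpos.le
    simp only [hV]
    rw [show (i + 1) * l = i * l + l by ring]
    refine key.trans ?_
    simp only [hθ]
    linarith
  have hV0n : 0 ≤ V 0 :=
    (norm_nonneg _).trans (norm_le_lyapunov (F := pseudogradient J) (xs := xs) hq₀ hq hq1
      hlam0.le (x (0 * l)) (ξ (0 * l)))
  obtain ⟨g1, g2⟩ := le_pow_mul_add_of_step hθ0.le hθ1 hd0.le hV0n hV0S hstep (le_refl (n / l))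
  obtain ⟨hxM, hξM⟩ := hball _ g2
  have hn : n / l * l ≤ n ∧ n ≤ n / l * l + l := by
    have h1 := Nat.div_add_mod n l
    have h2 := Nat.mod_lt n hl0
    rw [mul_comm] at h1
    omega
  have g3 := (H n e s τ μ x ξ hrun (n / l * l) hxM hξM).2 n hn.1 hn.2 le_rfl
  have g4 : ‖x (n / l * l) - xs‖ ≤ V (n / l) :=
    norm_le_lyapunov (F := pseudogradient J) hq₀ hq hq1 hlam0.le _ _
  have g5 : ‖x n - xs‖ ≤ ‖x n - x (n / l * l)‖ + ‖x (n / l * l) - xs‖ := by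
    simpa using norm_add_le (x n - x (n / l * l)) (x (n / l * l) - xs)
  -- The last incomplete block has at most l events and costs a factor exp θ ≤ exp 1, which is part
  -- of the constant A.
  have hexp : (1 - θ) ^ (n / l) ≤ Real.exp 1 * Real.exp (-(α * β * (c₀ / 2) * n)) := by
    have h1 : 1 - θ ≤ Real.exp (-θ) := by linarith [Real.add_one_le_exp (-θ)]
    refine (pow_le_pow_left₀ (by linarith) h1 _).trans ?_
    rw [← Real.exp_nat_mul, ← Real.exp_add]
    refine Real.exp_le_exp.mpr ?_
    have h2 : (n : ℝ) ≤ ((n / l : ℕ) : ℝ) * l + l := by exact_mod_cast hn.2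
    have h3 : α * β * (c₀ / 2) * n ≤ α * β * (c₀ / 2) * (((n / l : ℕ) : ℝ) * l + l) := by gcongr
    have h4 : α * β * (c₀ / 2) * (((n / l : ℕ) : ℝ) * l + l) = ((n / l : ℕ) : ℝ) * θ + θ := by
      simp only [hθ, hh]; ring
    linarith
  have hpow1 : (1 - θ) ^ (n / l) ≤ 1 := pow_le_one₀ (by linarith) (by linarith)
  have hpow0 : 0 ≤ (1 - θ) ^ (n / l) := pow_nonneg (by linarith) _
  have g6 : (1 - θ) ^ (n / l) * V 0
      ≤ (1 - θ) ^ (n / l) * (1 / q₀ * ‖x 0 - xs‖) + d := by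
    have h1 := mul_le_mul_of_nonneg_left hV0 hpow0
    have h2 : (1 - θ) ^ (n / l) * d ≤ d := mul_le_of_le_one_left hd0.le hpow1
    linarith
  have g7 : (1 - θ) ^ (n / l) * (1 / q₀ * ‖x 0 - xs‖)
      ≤ Real.exp 1 / q₀ * ‖x 0 - xs‖ * Real.exp (-(α * β * (c₀ / 2) * n)) := by
    refine (mul_le_mul_of_nonneg_right hexp (by positivity)).trans (le_of_eq ?_)
    ring
  linarith

end

/-- The bound of `exists_run_bound` decays in the number j of events. Since t ≤ T (j + 2) for the
period T of any one agent, t + j ≤ (T + 1)(j + 2): the decay rate is divided by T + 1, and the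
offset 2 costs a factor exp 2 because αβγ ≤ 1. -/
theorem zerothOrderAlgorithm_isSGPAS {N : ℕ} [Nonempty (Fin N)] {m : Fin N → ℕ}
    (J : Fin N → Decision m → ℝ)
    (hJ : ∀ i, ContDiff ℝ 1 (J i)) (μf L : ℝ) (hμf : 0 < μf) (hL : 0 < L)
    (hmono : ∀ x y : Decision m,
      μf * ‖x - y‖ ^ 2 ≤ inner ℝ (x - y) (pseudogradient J x - pseudogradient J y))
    (hLip : ∀ x y : Decision m, ‖pseudogradient J x - pseudogradient J y‖ ≤ L * ‖x - y‖)
    {xs : Decision m} (hxs : pseudogradient J xs = 0)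
    (T : Fin N → ℝ) (hT : ∀ i, 0 < T i) (r : Fin N → ℕ) (P : ℝ) (hr : ∀ i, r i * T i = P)
    (𝒯 : Set (Timers N)) (h𝒯 : IsTimerSet T 𝒯) (ω : Coord m → ℝ)
    (hself : ∀ c, ∀ z : ℤ, ω c ≠ Real.pi * z)
    (hres : ∀ c d : Coord m, c ≠ d → ∀ z : ℤ,
      ω c * r c.1 + ω d * r d.1 ≠ 2 * Real.pi * z ∧
      ω c * r c.1 - ω d * r d.1 ≠ 2 * Real.pi * z) :
    IsSGPAS (zerothOrderAlgorithm J ω T 𝒯) (stateSet {xs} 𝒯) filterState := by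
  obtain ⟨C, -, hC⟩ := exists_window_bound ω T hT r P hr hself hres
  obtain ⟨A, hA, γ, hγ, H⟩ := exists_run_bound J hJ μf L hμf hL hmono hLip hxs T hT ω C hC
  set i₀ : Fin N := Classical.arbitrary _
  have hTi := hT i₀
  refine ⟨_, isClassKL_mul_exp (C := A * Real.exp 2) (c := γ / (T i₀ + 1)) (by positivity)
    (by positivity), fun δ ν ρ hν hνδ hρ => ?_⟩
  obtain ⟨βs, hβs, H⟩ := H δ ν ρ hν (hν.trans hνδ) (by linarith)
  refine ⟨βs, hβs, fun β hβ => ?_⟩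
  obtain ⟨as, has, H⟩ := H β hβ
  refine ⟨as, has, fun a ha hρa => ?_⟩
  obtain ⟨αs, hαs, H⟩ := H a ha hρa
  refine ⟨αs, hαs, fun α hα dom φ hφ hφ0 hξ0 t j htj => ?_⟩
  obtain ⟨hαγ, H⟩ := H α hα
  rw [infDist_stateSet (init_mem_stateSet h𝒯 hφ)] at hφ0 ⊢
  rw [infDist_stateSet (mem_stateSet_of_mem_dom h𝒯 hφ htj)]
  obtain ⟨e, s, τ, μ, x, ξ, hrun, hx, hξ, hx0, hξ0', hxj, ht⟩ := exists_eventRun hT h𝒯 hφ htj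
  have key := H j e s τ μ x ξ ⟨hrun, hx, hξ⟩ (by rw [hx0]; exact hφ0) (by rw [hξ0']; exact hξ0)
  rw [hx0, hxj] at key
  refine key.trans (add_le_add_left ?_ _)
  have hle : γ / (T i₀ + 1) * (α * β * (t + j)) ≤ α * β * γ * j + 2 := by
    have h1 : t + j ≤ (T i₀ + 1) * (j + 2) := by linarith [ht i₀]
    have hαβ : 0 < α * β := mul_pos hα.1 hβ.1
    calc γ / (T i₀ + 1) * (α * β * (t + j))
        ≤ γ / (T i₀ + 1) * (α * β * ((T i₀ + 1) * (j + 2))) := by gcongr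
      _ = α * β * γ * j + 2 * (α * β * γ) := by field_simp
      _ ≤ α * β * γ * j + 2 := by linarith
  have hexp : Real.exp (-(α * β * γ * j))
      ≤ Real.exp 2 * Real.exp (-(γ / (T i₀ + 1) * (α * β * (t + j)))) := by
    rw [← Real.exp_add]
    exact Real.exp_le_exp.mpr (by linarith)
  refine (mul_le_mul_of_nonneg_left hexp (by positivity)).trans (le_of_eq ?_)
  ring

end

theorem theorem4 {N : ℕ} (m : Fin N → ℕ) (J : Fin N → Decision m → ℝ)
    -- regularity of the costs
    (hJ : ∀ i, ContDiff ℝ 1 (J i))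
    (hconv : ∀ i x, StrictConvexOn ℝ (agentSlice i x) (J i))
    -- strong monotonicity and Lipschitz continuity of the pseudogradient
    (μf L : ℝ) (hμf : 0 < μf)
    (hmono : ∀ x y : Decision m,
      μf * ‖x - y‖ ^ 2 ≤ inner ℝ (x - y) (pseudogradient J x - pseudogradient J y))
    (hLip : ∀ x y : Decision m,
      ‖pseudogradient J x - pseudogradient J y‖ ≤ L * ‖x - y‖)
    -- rationally related sampling periods
    (T : Fin N → ℝ) (hT : ∀ i, 0 < T i)
    (p : Fin N → ℕ) (hp : ∀ i, 0 < p i) (hratio : ∀ i j, T i * p j = T j * p i)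
    -- the set of admissible timer values
    (𝒯 : Set (Timers N)) (h𝒯 : IsTimerSet T 𝒯)
    -- non-resonant dither frequencies
    (ω : Coord m → ℝ) (hω : ∀ c, 0 < ω c)
    (hself : ∀ c, ∀ z : ℤ, ω c ≠ Real.pi * z)
    (hres : ∀ c d : Coord m, c ≠ d → ∀ z : ℤ,
      ω c * scaledRate p c.1 + ω d * scaledRate p d.1 ≠ 2 * Real.pi * z ∧
      ω c * scaledRate p c.1 - ω d * scaledRate p d.1 ≠ 2 * Real.pi * z) :
    ∃ xs : Decision m, (∀ x, IsNash J x ↔ x = xs) ∧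
      IsSGPAS (zerothOrderAlgorithm J ω T 𝒯) (stateSet {xs} 𝒯) filterState := by
  obtain ⟨xs, hxs, hnash⟩ := existsUnique_nash hJ (fun i x => (hconv i x).convexOn) μf L hμf hmono
    hLip
  refine ⟨xs, hnash, ?_⟩
  -- Without agents the decision space is a single point and every distance vanishes.
  rcases isEmpty_or_nonempty (Fin N) with hN | hN
  · refine ⟨_, isClassKL_mul_exp one_pos one_pos, fun δ ν ρ hν _ _ => ⟨1, one_pos, fun β _ =>
      ⟨1, one_pos, fun a _ _ => ⟨1, one_pos, fun α _ dom φ hφ _ _ t j htj => ?_⟩⟩⟩⟩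
    have : Subsingleton (Decision m) :=
      ⟨fun x y => by ext c; exact (IsEmpty.false c.1).elim⟩
    rw [infDist_stateSet (mem_stateSet_of_mem_dom h𝒯 hφ htj),
      infDist_stateSet (init_mem_stateSet h𝒯 hφ), Subsingleton.elim (φ t j).1 xs,
      Subsingleton.elim (φ 0 0).1 xs]
    simp [hν.le]
  · have hr : ∀ i, scaledRate p i * T i
        = (Finset.univ.lcm p : ℕ) * (T (Classical.arbitrary _) / p (Classical.arbitrary _)) := by
      intro i
      have hpi : (0 : ℝ) < p i := by exact_mod_cast hp i
      have hp0 : (0 : ℝ) < p (Classical.arbitrary (Fin N)) := by exact_mod_cast hp _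
      have hdvd : p i ∣ Finset.univ.lcm p := Finset.dvd_lcm (Finset.mem_univ i)
      rw [scaledRate, Nat.cast_div hdvd hpi.ne', div_mul_eq_mul_div, mul_div_assoc]
      congr 1
      rw [div_eq_div_iff hpi.ne' hp0.ne']
      exact hratio _ _
    -- The sign of L is not known; |L| + 1 is a positive Lipschitz constant.
    refine zerothOrderAlgorithm_isSGPAS J hJ μf (|L| + 1) hμf (by positivity) hmono
      (fun x y => (hLip x y).trans ?_) hxs T hT (scaledRate p) _ hr 𝒯 h𝒯 ω hself hres
    gcongr
    linarith [le_abs_self L]
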